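/- Consider functions $u=u(x,y,t)$ on the Heisenberg group $H^1\cong\mathbb R^3$ and the equation $$\Delta_{H^1}u+e^u=0,\qquad \Delta_{H^1}=\partial_x^2+\partial_y^2+4(x^2+y^2)\partial_t^2+4y\,\partial_x\partial_t-4x\,\partial_y\partial_t,$$ with the Lagrangian $$\mathcal L=\tfrac12u_x^2+\tfrac12u_y^2+2(x^2+y^2)u_t^2+2y\,u_xu_t-2x\,u_yu_t-F(u),\qquad F'(u)=e^u,$$ of which it is the Euler–Lagrange equation. Write $(x^1,x^2,x^3)=(x,y,t)$, and let $D_i$ denote the total derivative with respect to $x^i$. For a smooth vector field $S=\xi^i(x,y,t,u)\,\partial_{x^i}+\eta(x,y,t,u)\,\partial_u$ on $\mathbb R^3\times\mathbb R$ let $S^{(k)}$ be its extension to the $k$-th jet space, with coefficients $\eta^{(1)}_i=D_i\eta-(D_i\xi^j)u_j$ and $\eta^{(k)}_{i_1\cdots i_k}=D_{i_k}\eta^{(k-1)}_{i_1\cdots i_{k-1}}-(D_{i_k}\xi^l)u_{i_1\cdots i_{k-1}l}$. The field $S$ is a Lie point symmetry of the equation if $S^{(2)}(\Delta_{H^1}u+e^u)=0$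 at all 2-jets at which $\Delta_{H^1}u+e^u=0$; it is a Noether symmetry if, moreover, there are smooth functions $\varphi^1,\varphi^2,\varphi^3$ of $(x,y,t)$, $u$ and finitely many derivatives of $u$ such that $S^{(1)}\mathcal L+\mathcal L\,D_i\xi^i=D_i\varphi^i$ identically on jets. Then the Noether symmetries are exactly the elements of $G_f$, that is, the real linear combinations of $$T=\partial_t,\quad R=y\partial_x-x\partial_y,\quad \tilde X=\partial_x-2y\,\partial_t,\quad \tilde Y=\partial_y+2x\,\partial_t .$$ In particular, the field $E=x\partial_x+y\partial_y+2t\partial_t-2\partial_u$ is a Lie point symmetry of the equation but not a Noether symmetry. -/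

import Mathlib

open scoped ContDiff

noncomputable section

namespace KohnLaplace

/-! ### Jets of functions `u = u(x₀, x₁, x₂)`, where `(x₀, x₁, x₂) = (x, y, t)` -/

/-- The base manifold, with coordinates `(x, y, t) = (p 0, p 1, p 2)`. -/
abbrev Base : Type := Fin 3 → ℝ

/-- Multi-indices `α = (α₀, α₁, α₂)` of order at most `k`. -/
abbrev MultiIndex (k : ℕ) : Type := {α : Fin 3 → ℕ // ∑ i, α i ≤ k}

instance instFiniteMultiIndex (k : ℕ) : Finite (MultiIndex k) := by
  have hle : ∀ (α : MultiIndex k) (i : Fin 3), α.1 i < k + 1 := fun α i =>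
    Nat.lt_succ_of_le
      ((Finset.single_le_sum (fun j _ => Nat.zero_le (α.1 j)) (Finset.mem_univ i)).trans α.2)
  refine Finite.of_injective (fun (α : MultiIndex k) (i : Fin 3) => (⟨α.1 i, hle α i⟩ : Fin (k + 1)))
    (fun α β h => Subtype.ext (funext fun i => ?_))
  exact congrArg Fin.val (congrFun h i)

instance instFintypeMultiIndex (k : ℕ) : Fintype (MultiIndex k) := Fintype.ofFinite _

/-- The `k`-th order jet space: a point of it is `(x, u, ∂u, …, ∂ᵏu)`, with one real coordinate
`u_α` for every multi-index `α` of order at most `k`. -/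
abbrev Jet (k : ℕ) : Type := Base × (MultiIndex k → ℝ)

/-- Forgetting the derivatives of order larger than `m`. -/
def trunc {m k : ℕ} (h : m ≤ k) (z : Jet k) : Jet m :=
  (z.1, fun α => z.2 ⟨α.1, α.2.trans h⟩)

/-- The multi-index of the iterated derivative `∂_{i₁} ⋯ ∂_{iⱼ}`, for `l = [i₁, …, iⱼ]`. -/
def ofList (l : List (Fin 3)) : Fin 3 → ℕ := fun i => l.count i

theorem sum_ofList (l : List (Fin 3)) : ∑ i, ofList l i = l.length := by
  induction l with
  | nil => simp [ofList]
  | cons a l ih =>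
    have h : ∀ i, ofList (a :: l) i = ofList l i + if a = i then 1 else 0 := by
      intro i
      simp [ofList, List.count_cons]
    simp [h, Finset.sum_add_distrib, ih]

/-- The index of the coordinate `u_{i₁ ⋯ iⱼ}` of the jet space, for `l = [i₁, …, iⱼ]`. -/
def idx {k : ℕ} (l : List (Fin 3)) (h : l.length ≤ k) : MultiIndex k :=
  ⟨ofList l, (sum_ofList l).le.trans h⟩

/-- The coordinate `u_{i₁ ⋯ iⱼ}` of a jet, for `l = [i₁, …, iⱼ]`; the empty list gives `u`. -/
def coord {k : ℕ} (z : Jet k) (l : List (Fin 3)) (h : l.length ≤ k) : ℝ := z.2 (idx l h)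

/-- The point `(x, u)` under a jet. -/
def point {k : ℕ} (z : Jet k) : Base × ℝ := (z.1, coord z [] (Nat.zero_le k))

/-- A list `[0, …, 0, 1, …, 1, 2, …, 2]` representing the multi-index `α`. -/
def toList (α : Fin 3 → ℕ) : List (Fin 3) :=
  List.replicate (α 0) 0 ++ List.replicate (α 1) 1 ++ List.replicate (α 2) 2

theorem length_toList (α : Fin 3 → ℕ) : (toList α).length = ∑ i, α i := by
  simp [toList, Fin.sum_univ_three, add_assoc]

theorem sum_add_single {k : ℕ} (i : Fin 3) (α : MultiIndex k) :
    ∑ j, (α.1 + Pi.single i 1 : Fin 3 → ℕ) j ≤ k + 1 := by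
  have h := α.2
  simpa [Finset.sum_add_distrib] using h

/-- The total derivative `D_i P = ∂P/∂xⁱ + ∑_α u_{α + eᵢ} ∂P/∂u_α` of a function on the
`k`-th jet space; it is a function on the `(k + 1)`-st jet space. The sum of the partial
derivatives is written as the derivative of `P` in the direction `(eᵢ, (u_{α + eᵢ})_α)`. -/
def totalDeriv {k : ℕ} (i : Fin 3) (P : Jet k → ℝ) : Jet (k + 1) → ℝ := fun z =>
  fderiv ℝ P (trunc (Nat.le_succ k) z)
    (Pi.single i 1, fun α => z.2 ⟨α.1 + Pi.single i 1, sum_add_single i α⟩)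

/-! ### Point symmetries and Noether symmetries -/

/-- A vector field `S = ξⁱ(x, u) ∂/∂xⁱ + η(x, u) ∂/∂u` on `ℝ³ × ℝ`; its value at `(x, u)` is
`(ξ(x, u), η(x, u))`. -/
abbrev PointField : Type := Base × ℝ → Base × ℝ

/-- The coefficient `ξʲ`, as a function on the jet space of order zero. -/
def xi (S : PointField) (j : Fin 3) : Jet 0 → ℝ := fun z => (S (point z)).1 j

/-- The coefficients of the extended vector field: the list `[]` gives `η`, and
`η_{i l} = D_i η_l - (D_i ξʲ) u_{j l}`. -/
def extCoeff (S : PointField) : (l : List (Fin 3)) → Jet l.length → ℝ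
  | [] => fun z => (S (point z)).2
  | i :: l => fun z =>
      totalDeriv i (extCoeff S l) z
        - ∑ j, totalDeriv i (xi S j) (trunc (Nat.succ_le_succ (Nat.zero_le l.length)) z)
            * coord z (j :: l) (le_refl (l.length + 1))

/-- The extended vector field `S^{(k)} = ξⁱ ∂/∂xⁱ + ∑_{|α| ≤ k} η_α ∂/∂u_α`, acting on
functions on the `k`-th jet space. -/
def extend {k : ℕ} (S : PointField) (P : Jet k → ℝ) : Jet k → ℝ := fun z =>
  fderiv ℝ P z
    ((S (point z)).1,
      fun α => extCoeff S (toList α.1) (trunc ((length_toList α.1).le.trans α.2) z))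

/-- `S` is a (smooth) Lie point symmetry of the equation `P(x, u, ∂u, …, ∂ᵏu) = 0`:
`S^{(k)} P = 0` whenever `P = 0`. -/
def IsLiePointSymmetry {k : ℕ} (P : Jet k → ℝ) (S : PointField) : Prop :=
  ContDiff ℝ ∞ S ∧ ∀ z, P z = 0 → extend S P z = 0

/-- The partial derivative `∂P/∂u_{i₁ ⋯ iⱼ}`, for `l = [i₁, …, iⱼ]`. -/
def partialU {k : ℕ} (l : List (Fin 3)) (h : l.length ≤ k) (P : Jet k → ℝ) : Jet k → ℝ := fun z =>
  fderiv ℝ P z (0, Pi.single (idx l h) 1)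

/-- The Euler-Lagrange expression `∂L/∂u - D_i (∂L/∂u_i)` of a first order Lagrangian. -/
def eulerLagrange (L : Jet 1 → ℝ) : Jet 2 → ℝ := fun z =>
  partialU [] (Nat.zero_le 1) L (trunc one_le_two z)
    - ∑ i, totalDeriv i (partialU [i] (le_refl 1) L) z

/-- The equation `P = 0` is the Euler-Lagrange equation of the Lagrangian `L`. -/
def IsDerivedFrom (P : Jet 2 → ℝ) (L : Jet 1 → ℝ) : Prop :=
  ∀ z, eulerLagrange L z = 0 ↔ P z = 0

/-- `S` is a Noether symmetry of the equation `P = 0` with Lagrangian `L`: the equation is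
derived from `L`, `S` is a Lie point symmetry of it, and `S^{(1)} L + L D_i ξⁱ = D_i φⁱ` for some
vector `φ` of smooth functions of `(x, u, ∂u, …, ∂ᵐu)`, where the order `m` is arbitrary. -/
def IsNoetherSymmetry (P : Jet 2 → ℝ) (L : Jet 1 → ℝ) (S : PointField) : Prop :=
  IsDerivedFrom P L ∧ IsLiePointSymmetry P S ∧
    ∃ (m : ℕ) (φ : Fin 3 → Jet m → ℝ), (∀ i, ContDiff ℝ ∞ (φ i)) ∧
      ∀ z : Jet (m + 1),
        let z₁ : Jet 1 := trunc (Nat.succ_le_succ (Nat.zero_le m)) z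
        extend S L z₁ + L z₁ * ∑ i, totalDeriv i (xi S i) z₁ = ∑ i, totalDeriv i (φ i) z

/-! ### The semilinear Kohn-Laplace equation -/

/-- The left-hand side of `Δ_{H¹} u + f(u) = 0`, where
`Δ_{H¹} u = u_xx + u_yy + 4 (x² + y²) u_tt + 4 y u_xt - 4 x u_yt`. -/
def equation (f : ℝ → ℝ) : Jet 2 → ℝ := fun z =>
  let x := z.1 0
  let y := z.1 1
  let u := coord z [] (Nat.zero_le 2)
  let d := fun i j : Fin 3 => coord z [i, j] (le_refl 2)
  d 0 0 + d 1 1 + 4 * (x ^ 2 + y ^ 2) * d 2 2 + 4 * y * d 0 2 - 4 * x * d 1 2 + f u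

/-- The Lagrangian `½ u_x² + ½ u_y² + 2 (x² + y²) u_t² + 2 y u_x u_t - 2 x u_y u_t - F(u)`. -/
def lagrangian (F : ℝ → ℝ) : Jet 1 → ℝ := fun z =>
  let x := z.1 0
  let y := z.1 1
  let u := coord z [] (Nat.zero_le 1)
  let ux := coord z [0] (le_refl 1)
  let uy := coord z [1] (le_refl 1)
  let ut := coord z [2] (le_refl 1)
  1 / 2 * ux ^ 2 + 1 / 2 * uy ^ 2 + 2 * (x ^ 2 + y ^ 2) * ut ^ 2
    + 2 * y * ux * ut - 2 * x * uy * ut - F u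

/-- `T = ∂_t`. -/
def fieldT : PointField := fun _ => (![0, 0, 1], 0)

/-- `R = y ∂_x - x ∂_y`. -/
def fieldR : PointField := fun q => (![q.1 1, -q.1 0, 0], 0)

/-- `X̃ = ∂_x - 2 y ∂_t`. -/
def fieldX : PointField := fun q => (![1, 0, -2 * q.1 1], 0)

/-- `Ỹ = ∂_y + 2 x ∂_t`. -/
def fieldY : PointField := fun q => (![0, 1, 2 * q.1 0], 0)

/-- `E = x ∂_x + y ∂_y + 2 t ∂_t - 2 ∂_u`. -/
def fieldE : PointField := fun q => (![q.1 0, q.1 1, 2 * q.1 2], -2)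

/-- `G_f`, given by its infinitesimal generators: the span of `T`, `R`, `X̃` and `Ỹ`. -/
def generatorsG : Submodule ℝ PointField := Submodule.span ℝ {fieldT, fieldR, fieldX, fieldY}

end KohnLaplace

end

noncomputable section

namespace KohnLaplace

/-! ### Calculus on jet spaces -/

/-! The argument has two independent halves, built on the left-invariant fields X = ∂_x + 2y∂_t and
Y = ∂_y - 2x∂_t, with [X,Y] = -4∂_t, Δ = X² + Y², and Lagrangian ½(Xu)² + ½(Yu)² - F(u).

Point symmetries (`eq_combination_of_isLiePointSymmetry`). Solving the equation for u_xx leaves an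
identity polynomial in the remaining jet coordinates (`lie_identity`), and its coefficients are the
determining equations. The ξ^i do not depend on u. Independence of 1, u, e^u and u e^u forces η_u =
0 and η = -2Xξ^1 (`fiberCoeff_eq`). What is left says that S preserves the contact structure, acts
conformally on the frame X, Y, and has Kohn-harmonic ξ^1, ξ^2. Commutators reduce this to constant
first derivatives, so S is a combination of X̃, Ỹ, T, R and κE.

Noether condition (`eq_zero_of_isNoetherSymmetry_combination`). For such S the left side of the
Noether identity equals 2κ(L + e^u - F) (`noether_combination`). It vanishes if κ = 0, so φ = 0
works. Otherwise the identity is evaluated on a nonpositive, compactly supported u and on u = 0, and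
the two are subtracted. One side is then the divergence of a compactly supported field and has
integral zero. The other is 2κ times ½(Xu)² + ½(Yu)² + 1 - e^u, which is nonnegative and not
identically zero. Hence κ = 0, whatever the order of the φ^i. -/

theorem ofList_add_single (l : List (Fin 3)) (i : Fin 3) :
    ofList l + Pi.single i 1 = ofList (i :: l) := by
  funext j
  by_cases h : j = i
  · subst h; simp [ofList]
  · simp [ofList, h, Ne.symm h]

theorem coord_perm {k : ℕ} (z : Jet k) {l l' : List (Fin 3)} (hp : l.Perm l')
    (h : l.length ≤ k) (h' : l'.length ≤ k) : coord z l h = coord z l' h' := by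
  have : ofList l = ofList l' := funext fun i => hp.count_eq i
  exact congrArg z.2 (Subtype.ext this)

theorem coord_swap {k : ℕ} (z : Jet k) (i j : Fin 3) (h : 2 ≤ k) :
    coord z [i, j] h = coord z [j, i] h :=
  coord_perm z (List.Perm.swap _ _ _) _ _

/-- The direction in which the total derivative `D_i` differentiates. -/
def shift {k : ℕ} (i : Fin 3) (z : Jet (k + 1)) : Jet k :=
  (Pi.single i 1, fun α => z.2 ⟨α.1 + Pi.single i 1, sum_add_single i α⟩)

theorem coord_shift {k : ℕ} (i : Fin 3) (z : Jet (k + 1)) (l : List (Fin 3)) (h : l.length ≤ k) :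
    coord (shift i z) l h = coord z (i :: l) (Nat.succ_le_succ h) :=
  congrArg z.2 (Subtype.ext (ofList_add_single l i))

/-- A coordinate of the jet space, as a continuous linear form. -/
def coordL {k : ℕ} (l : List (Fin 3)) (h : l.length ≤ k) : Jet k →L[ℝ] ℝ :=
  (ContinuousLinearMap.proj (idx l h)).comp (ContinuousLinearMap.snd ℝ Base (MultiIndex k → ℝ))

theorem coordL_apply {k : ℕ} (l : List (Fin 3)) (h : l.length ≤ k) (z : Jet k) :
    coordL l h z = coord z l h := rfl

theorem hasFDerivAt_coord {k : ℕ} (l : List (Fin 3)) (h : l.length ≤ k) (z : Jet k) :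
    HasFDerivAt (fun z : Jet k => coord z l h) (coordL l h) z :=
  (coordL l h).hasFDerivAt

/-- A coordinate of the base, as a continuous linear form on the jet space. -/
def baseL {k : ℕ} (i : Fin 3) : Jet k →L[ℝ] ℝ :=
  (ContinuousLinearMap.proj i).comp (ContinuousLinearMap.fst ℝ Base (MultiIndex k → ℝ))

theorem baseL_apply {k : ℕ} (i : Fin 3) (z : Jet k) : baseL i z = z.1 i := rfl

theorem hasFDerivAt_base {k : ℕ} (i : Fin 3) (z : Jet k) :
    HasFDerivAt (fun z : Jet k => z.1 i) (baseL i) z :=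
  (baseL i).hasFDerivAt

/-- The projection of the jet space to `ℝ³ × ℝ`, as a continuous linear map. -/
def pointL (k : ℕ) : Jet k →L[ℝ] Base × ℝ :=
  (ContinuousLinearMap.fst ℝ Base (MultiIndex k → ℝ)).prod (coordL [] (Nat.zero_le k))

theorem pointL_apply {k : ℕ} (z : Jet k) : pointL k z = point z := rfl

theorem hasFDerivAt_point {k : ℕ} (z : Jet k) :
    HasFDerivAt (fun z : Jet k => point z) (pointL k) z :=
  (pointL k).hasFDerivAt

theorem totalDeriv_eq {k : ℕ} {P : Jet k → ℝ} {P' : Jet k →L[ℝ] ℝ} {i : Fin 3} {z : Jet (k + 1)}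
    (h : HasFDerivAt P P' (trunc (Nat.le_succ k) z)) :
    totalDeriv i P z = P' (shift i z) := by
  unfold totalDeriv
  rw [h.fderiv]
  rfl

/-- The direction `∂_i + c ∂_u` on `ℝ³ × ℝ`. -/
def lift (i : Fin 3) (c : ℝ) : Base × ℝ := (Pi.single i 1, c)

theorem totalDeriv_xi {S : PointField} (hS : ContDiff ℝ ∞ S) (i j : Fin 3) (z : Jet 1) :
    totalDeriv i (xi S j) z
      = (fderiv ℝ S (point z) (lift i (coord z [i] (le_refl 1)))).1 j := by
  have hd : Differentiable ℝ S := hS.differentiable (by simp)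
  have h := ((hd (point (trunc (Nat.le_succ 0) z))).hasFDerivAt.comp _
    (hasFDerivAt_point (trunc (Nat.le_succ 0) z)))
  have h1 := ((ContinuousLinearMap.proj (R := ℝ) (φ := fun _ : Fin 3 => ℝ) j).comp
    (ContinuousLinearMap.fst ℝ Base ℝ)).hasFDerivAt.comp _ h
  have := totalDeriv_eq (i := i) h1
  refine Eq.trans this ?_
  have e : pointL 0 (shift i z) = lift i (coord z [i] (le_refl 1)) := by
    rw [pointL_apply]; unfold point; rw [coord_shift]; rfl
  simp only [ContinuousLinearMap.comp_apply, e]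
  rfl

theorem extCoeff_singleton {S : PointField} (hS : ContDiff ℝ ∞ S) (i : Fin 3) (z : Jet 1) :
    extCoeff S [i] z = (fderiv ℝ S (point z) (lift i (coord z [i] (le_refl 1)))).2
      - ∑ j, (fderiv ℝ S (point z) (lift i (coord z [i] (le_refl 1)))).1 j
        * coord z [j] (le_refl 1) := by
  have hd : Differentiable ℝ S := hS.differentiable (by simp)
  have h := ((hd (point (trunc (Nat.le_succ 0) z))).hasFDerivAt.comp _
    (hasFDerivAt_point (trunc (Nat.le_succ 0) z)))
  have h1 := (ContinuousLinearMap.snd ℝ Base ℝ).hasFDerivAt.comp _ h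
  have := totalDeriv_eq (i := i) h1
  unfold extCoeff
  congr 1
  · refine Eq.trans this ?_
    have e : pointL 0 (shift i z) = lift i (coord z [i] (le_refl 1)) := by
      rw [pointL_apply]; unfold point; rw [coord_shift]; rfl
    simp only [ContinuousLinearMap.comp_apply, e]
    rfl
  · exact Finset.sum_congr rfl fun j _ => by rw [totalDeriv_xi hS]; rfl

/-- Obtained by applying D_i to the formula of `extCoeff_singleton`. The direction `lift j u_j`
itself depends on the jet, with D_i-derivative (0, u_ij); this produces the terms containing `fderiv
ℝ S (point z) (0, 1)`. -/
theorem extCoeff_pair {S : PointField} (hS : ContDiff ℝ ∞ S) (i j : Fin 3) (z : Jet 2) :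
    extCoeff S [i, j] z =
      (fderiv ℝ (fderiv ℝ S) (point z) (lift i (coord z [i] one_le_two))
          (lift j (coord z [j] one_le_two))).2
        + (fderiv ℝ S (point z) (0, 1)).2 * coord z [i, j] (le_refl 2)
        - ∑ k, (((fderiv ℝ (fderiv ℝ S) (point z) (lift i (coord z [i] one_le_two))
              (lift j (coord z [j] one_le_two))).1 k
            + (fderiv ℝ S (point z) (0, 1)).1 k * coord z [i, j] (le_refl 2))
              * coord z [k] one_le_two
            + (fderiv ℝ S (point z) (lift j (coord z [j] one_le_two))).1 k
              * coord z [i, k] (le_refl 2)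
            + (fderiv ℝ S (point z) (lift i (coord z [i] one_le_two))).1 k
              * coord z [k, j] (le_refl 2)) := by
  have hd : Differentiable ℝ (fderiv ℝ S) :=
    (hS.fderiv_right (m := ∞) (by simp)).differentiable (by simp)
  set w : Jet 1 := trunc (Nat.le_succ 1) z with hw
  have h := (hd (point w)).hasFDerivAt.comp w (hasFDerivAt_point w)
  have hl : HasFDerivAt (fun w : Jet 1 => lift j (coord w [j] (le_refl 1)))
      ((0 : Jet 1 →L[ℝ] Base).prod (coordL [j] (le_refl 1))) w :=
    (hasFDerivAt_const _ _).prodMk (hasFDerivAt_coord _ _ _)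
  have hc := h.clm_apply hl
  have h2 := (ContinuousLinearMap.snd ℝ Base ℝ).hasFDerivAt.comp w hc
  have h1 := fun k => ((ContinuousLinearMap.proj (R := ℝ) (φ := fun _ : Fin 3 => ℝ) k).comp
    (ContinuousLinearMap.fst ℝ Base ℝ)).hasFDerivAt.comp w hc
  have hm := fun k => (h1 k).mul (hasFDerivAt_coord [k] (le_refl 1) w)
  have hs := HasFDerivAt.fun_sum (u := Finset.univ) fun k _ => hm k
  have hall := h2.sub hs
  have hf : extCoeff S [j] = _ := funext (extCoeff_singleton hS j)
  have e : pointL 1 (shift i z) = lift i (coord z [i] one_le_two) := by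
    rw [pointL_apply]; unfold point; rw [coord_shift]; rfl
  have hsc : fderiv ℝ S (point w) (0, coord z [i, j] (le_refl 2))
      = coord z [i, j] (le_refl 2) • fderiv ℝ S (point w) (0, 1) := by
    rw [← map_smul]; simp
  have key := totalDeriv_eq (i := i) hall
  conv_lhs => unfold extCoeff
  rw [hf]
  refine (congrArg (· - _) key).trans ?_
  simp only [sub_apply, sum_apply,
    add_apply, smul_apply, ContinuousLinearMap.comp_apply,
    e, coordL_apply, coord_shift, ContinuousLinearMap.flip_apply,
    ContinuousLinearMap.prod_apply, totalDeriv_xi hS, zero_apply,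
    Function.comp_apply, hsc, ContinuousLinearMap.coe_snd', ContinuousLinearMap.coe_fst',
    ContinuousLinearMap.proj_apply, Prod.snd_add, Prod.fst_add, Prod.smul_fst, Prod.smul_snd,
    Pi.add_apply, Pi.smul_apply, smul_eq_mul]
  rw [sub_sub, ← Finset.sum_add_distrib]
  congr 1
  · rw [add_comm, mul_comm (coord z [i, j] _)]; rfl
  · refine Finset.sum_congr rfl fun k _ => ?_
    have c1 : ∀ l h, coord w l h = coord z l (h.trans one_le_two) := fun _ _ => rfl
    have c2 : point w = point z := rfl
    have c3 : ∀ h, trunc h z = w := fun _ => rfl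
    simp only [List.length_cons, List.length_nil, c3, c1, c2]
    ring

theorem extCoeff_congr (S : PointField) {k : ℕ} {l l' : List (Fin 3)} (e : l = l')
    (h : l.length ≤ k) (h' : l'.length ≤ k) (z : Jet k) :
    extCoeff S l (trunc h z) = extCoeff S l' (trunc h' z) := by
  subst e; rfl

/-- The direction in which the extension of `S` differentiates. -/
def extDir (S : PointField) {k : ℕ} (z : Jet k) : Jet k :=
  ((S (point z)).1,
    fun α => extCoeff S (toList α.1) (trunc ((length_toList α.1).le.trans α.2) z))

theorem extend_eq {S : PointField} {k : ℕ} {P : Jet k → ℝ} {P' : Jet k →L[ℝ] ℝ} {z : Jet k}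
    (h : HasFDerivAt P P' z) : extend S P z = P' (extDir S z) := by
  unfold extend
  rw [h.fderiv]
  rfl

/-- The extension assigns to a multi-index the coefficient of its sorted list, so a coefficient can
be read off directly only for sorted `l`; this is the role of `hl`. -/
theorem coord_extDir (S : PointField) {k : ℕ} (z : Jet k) (l : List (Fin 3)) (h : l.length ≤ k)
    (hl : toList (ofList l) = l) : coord (extDir S z) l h = extCoeff S l (trunc h z) :=
  extCoeff_congr S hl _ _ z

/-! ### Action of an extended field on the equation, and the differential of the Lagrangian. -/

theorem extend_equation (S : PointField) (z : Jet 2) :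
    extend S (equation Real.exp) z =
      extCoeff S [0, 0] z + extCoeff S [1, 1] z
        + 4 * (z.1 0 ^ 2 + z.1 1 ^ 2) * extCoeff S [2, 2] z
        + 4 * z.1 1 * extCoeff S [0, 2] z - 4 * z.1 0 * extCoeff S [1, 2] z
        + 8 * (z.1 0 * (S (point z)).1 0 + z.1 1 * (S (point z)).1 1) * coord z [2, 2] (le_refl 2)
        + 4 * (S (point z)).1 1 * coord z [0, 2] (le_refl 2)
        - 4 * (S (point z)).1 0 * coord z [1, 2] (le_refl 2)
        + Real.exp (coord z [] (Nat.zero_le 2)) * (S (point z)).2 := by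
  have hx := hasFDerivAt_base 0 z
  have hy := hasFDerivAt_base 1 z
  have hd := fun i j : Fin 3 => hasFDerivAt_coord [i, j] (le_refl 2) z
  have hu := (hasFDerivAt_coord [] (Nat.zero_le 2) z).exp
  have h := ((((((hd 0 0).add (hd 1 1)).add
    (((((hx.pow 2).add (hy.pow 2))).const_mul 4).mul (hd 2 2))).add
    ((hy.const_mul 4).mul (hd 0 2))).sub ((hx.const_mul 4).mul (hd 1 2))).add hu)
  refine (extend_eq (P := equation Real.exp) h).trans ?_
  have e : ∀ l h, toList (ofList l) = l → coord (extDir S z) l h = extCoeff S l (trunc h z) :=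
    fun l h hl => coord_extDir S z l h hl
  simp only [sub_apply, add_apply,
    smul_apply, coordL_apply, baseL_apply]
  rw [e [0, 0] _ (by decide), e [1, 1] _ (by decide), e [2, 2] _ (by decide),
    e [0, 2] _ (by decide), e [1, 2] _ (by decide), e [] _ (by decide)]
  have e0 : extCoeff S [] (trunc (Nat.zero_le 2) z) = (S (point z)).2 := rfl
  have e1 : ∀ i, (extDir S z).1 i = (S (point z)).1 i := fun _ => rfl
  have e2 : ∀ i j : Fin 3, extCoeff S [i, j] (trunc (le_refl 2) z) = extCoeff S [i, j] z :=
    fun _ _ => rfl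
  simp only [e0, e1, smul_eq_mul, Pi.add_apply]
  simp only [List.length_cons, List.length_nil, Nat.reduceAdd, e2]
  simp
  ring

theorem hasFDerivAt_lagrangian {F : ℝ → ℝ} (hF : ∀ u, HasDerivAt F (Real.exp u) u) (z : Jet 1) :
    ∃ L' : Jet 1 →L[ℝ] ℝ, HasFDerivAt (lagrangian F) L' z ∧ ∀ v : Jet 1, L' v =
      (coord z [0] (le_refl 1) + 2 * z.1 1 * coord z [2] (le_refl 1)) * coord v [0] (le_refl 1)
      + (coord z [1] (le_refl 1) - 2 * z.1 0 * coord z [2] (le_refl 1)) * coord v [1] (le_refl 1)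
      + (4 * (z.1 0 ^ 2 + z.1 1 ^ 2) * coord z [2] (le_refl 1)
          + 2 * z.1 1 * coord z [0] (le_refl 1) - 2 * z.1 0 * coord z [1] (le_refl 1))
        * coord v [2] (le_refl 1)
      + (4 * z.1 0 * coord z [2] (le_refl 1) ^ 2
          - 2 * coord z [1] (le_refl 1) * coord z [2] (le_refl 1)) * v.1 0
      + (4 * z.1 1 * coord z [2] (le_refl 1) ^ 2
          + 2 * coord z [0] (le_refl 1) * coord z [2] (le_refl 1)) * v.1 1
      - Real.exp (coord z [] (Nat.zero_le 1)) * coord v [] (Nat.zero_le 1) := by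
  have hx := hasFDerivAt_base 0 z
  have hy := hasFDerivAt_base 1 z
  have hd := fun i : Fin 3 => hasFDerivAt_coord [i] (le_refl 1) z
  have hu := (hF _).comp_hasFDerivAt z (hasFDerivAt_coord [] (Nat.zero_le 1) z)
  have h := (((((((hd 0).pow 2).const_mul (1 / 2)).add (((hd 1).pow 2).const_mul (1 / 2))).add
    ((((hx.pow 2).add (hy.pow 2)).const_mul 2).mul ((hd 2).pow 2))).add
    (((hy.const_mul 2).mul (hd 0)).mul (hd 2))).sub
    (((hx.const_mul 2).mul (hd 1)).mul (hd 2))).sub hu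
  refine ⟨_, h, fun v => ?_⟩
  simp only [sub_apply, add_apply,
    smul_apply, coordL_apply, baseL_apply, smul_eq_mul]
  simp
  ring

/-! ### The action of the known symmetries -/

/-- The linear combination `a X̃ + b Ỹ + c T + r R + κ E`. -/
def combination (a b c r κ : ℝ) : PointField := fun q =>
  (![a + r * q.1 1 + κ * q.1 0, b - r * q.1 0 + κ * q.1 1,
    c - 2 * a * q.1 1 + 2 * b * q.1 0 + 2 * κ * q.1 2], -2 * κ)

theorem combination_eq (a b c r κ : ℝ) : combination a b c r κ =
    a • fieldX + b • fieldY + c • fieldT + r • fieldR + κ • fieldE := by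
  funext q
  refine Prod.ext (funext fun i => ?_) ?_
  · fin_cases i <;> simp [combination, fieldX, fieldY, fieldT, fieldR, fieldE] <;> ring
  · simp [combination, fieldX, fieldY, fieldT, fieldR, fieldE]
    ring

/-- The linear part of `combination a b c r κ`. -/
def combinationL (a b r κ : ℝ) : Base × ℝ →L[ℝ] Base × ℝ :=
  LinearMap.toContinuousLinearMap
    { toFun := fun v => (![r * v.1 1 + κ * v.1 0, -r * v.1 0 + κ * v.1 1,
        -2 * a * v.1 1 + 2 * b * v.1 0 + 2 * κ * v.1 2], 0)
      map_add' := fun v w => by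
        refine Prod.ext (funext fun i => ?_) (by simp)
        fin_cases i <;> simp <;> ring
      map_smul' := fun s v => by
        refine Prod.ext (funext fun i => ?_) (by simp)
        fin_cases i <;> simp <;> ring }

theorem combinationL_apply (a b r κ : ℝ) (v : Base × ℝ) : combinationL a b r κ v =
    (![r * v.1 1 + κ * v.1 0, -r * v.1 0 + κ * v.1 1,
      -2 * a * v.1 1 + 2 * b * v.1 0 + 2 * κ * v.1 2], 0) := rfl

theorem combination_eq_const_add (a b c r κ : ℝ) : combination a b c r κ =
    fun q => (![a, b, c], -2 * κ) + combinationL a b r κ q := by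
  funext q
  rw [combinationL_apply]
  refine Prod.ext (funext fun i => ?_) (by simp [combination])
  fin_cases i <;> simp [combination] <;> ring

theorem contDiff_combination (a b c r κ : ℝ) : ContDiff ℝ ∞ (combination a b c r κ) := by
  rw [combination_eq_const_add]
  exact contDiff_const.add (combinationL a b r κ).contDiff

theorem fderiv_combination (a b c r κ : ℝ) :
    fderiv ℝ (combination a b c r κ) = fun _ => combinationL a b r κ := by
  funext q
  rw [combination_eq_const_add, fderiv_const_add, ContinuousLinearMap.fderiv]

/-- The coefficients are affine, so second derivatives of the field drop out. The four generators of
`generatorsG` annihilate the left-hand side of the equation, while E multiplies it by its weight -2.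
-/
theorem extend_equation_combination (a b c r κ : ℝ) (z : Jet 2) :
    extend (combination a b c r κ) (equation Real.exp) z = -2 * κ * equation Real.exp z := by
  rw [extend_equation]
  simp only [extCoeff_pair (contDiff_combination a b c r κ), fderiv_combination,
    Fin.sum_univ_three, combinationL_apply, lift, equation]
  rw [coord_swap z 2 0, coord_swap z 2 1, coord_swap z 1 0]
  simp [combination, point]
  ring

/-- Only E contributes. Its divergence is 4, the quadratic part Q of L has weight -2, and -F(u)
changes by 2e^u; the total is 2Q - 4F + 2e^u, where Q = L + F. -/
theorem noether_combination {F : ℝ → ℝ} (hF : ∀ u, HasDerivAt F (Real.exp u) u)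
    (a b c r κ : ℝ) (z : Jet 1) :
    extend (combination a b c r κ) (lagrangian F) z
        + lagrangian F z * ∑ i, totalDeriv i (xi (combination a b c r κ) i) z
      = 2 * κ * (lagrangian F z + Real.exp (coord z [] (Nat.zero_le 1))
          - F (coord z [] (Nat.zero_le 1))) := by
  obtain ⟨L', hL, h⟩ := hasFDerivAt_lagrangian hF z
  have e : ∀ i : Fin 3, coord (extDir (combination a b c r κ) z) [i] (le_refl 1)
      = extCoeff (combination a b c r κ) [i] z := fun i =>
    coord_extDir _ z [i] (le_refl 1) (by revert i; decide)
  have e0 : coord (extDir (combination a b c r κ) z) [] (Nat.zero_le 1) = -2 * κ :=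
    coord_extDir _ z [] (Nat.zero_le 1) (by decide)
  have e1 : (extDir (combination a b c r κ) z).1 = (combination a b c r κ (point z)).1 := rfl
  rw [extend_eq hL, h]
  simp only [e, e0, e1, extCoeff_singleton (contDiff_combination a b c r κ),
    totalDeriv_xi (contDiff_combination a b c r κ), fderiv_combination,
    Fin.sum_univ_three, combinationL_apply, lift, lagrangian]
  simp [combination, point]
  ring

theorem isDerivedFrom_lagrangian {F : ℝ → ℝ} (hF : ∀ u, HasDerivAt F (Real.exp u) u) :
    IsDerivedFrom (equation Real.exp) (lagrangian F) := by
  have hp : ∀ (l : List (Fin 3)) (h : l.length ≤ 1) (l' : List (Fin 3)) (h' : l'.length ≤ 1),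
      coord ((0, Pi.single (idx l h) 1) : Jet 1) l' h' = if ofList l' = ofList l then 1 else 0 := by
    intro l h l' h'
    simp [coord, idx, Pi.single_apply]
  have d0 : ofList [0] ≠ ofList [1] := by decide
  have d1 : ofList [0] ≠ ofList [2] := by decide
  have d2 : ofList [1] ≠ ofList [2] := by decide
  have d3 : ofList [0] ≠ ofList [] := by decide
  have d4 : ofList [1] ≠ ofList [] := by decide
  have d5 : ofList [2] ≠ ofList [] := by decide
  have pu : partialU [] (Nat.zero_le 1) (lagrangian F)
      = fun z => -Real.exp (coord z [] (Nat.zero_le 1)) := by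
    funext z
    obtain ⟨L', hL, h⟩ := hasFDerivAt_lagrangian hF z
    rw [partialU, hL.fderiv, h]
    simp [hp, d3, d4, d5]
  have p0 : partialU [0] (le_refl 1) (lagrangian F)
      = fun z => coord z [0] (le_refl 1) + 2 * z.1 1 * coord z [2] (le_refl 1) := by
    funext z
    obtain ⟨L', hL, h⟩ := hasFDerivAt_lagrangian hF z
    rw [partialU, hL.fderiv, h]
    simp [hp, d0.symm, d1.symm, d3.symm]
  have p1 : partialU [1] (le_refl 1) (lagrangian F)
      = fun z => coord z [1] (le_refl 1) - 2 * z.1 0 * coord z [2] (le_refl 1) := by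
    funext z
    obtain ⟨L', hL, h⟩ := hasFDerivAt_lagrangian hF z
    rw [partialU, hL.fderiv, h]
    simp [hp, d0, d2.symm, d4.symm]
  have p2 : partialU [2] (le_refl 1) (lagrangian F)
      = fun z => 4 * (z.1 0 ^ 2 + z.1 1 ^ 2) * coord z [2] (le_refl 1)
          + 2 * z.1 1 * coord z [0] (le_refl 1) - 2 * z.1 0 * coord z [1] (le_refl 1) := by
    funext z
    obtain ⟨L', hL, h⟩ := hasFDerivAt_lagrangian hF z
    rw [partialU, hL.fderiv, h]
    simp [hp, d1, d2, d5.symm]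
  have key : ∀ z, eulerLagrange (lagrangian F) z = -equation Real.exp z := by
    intro z
    set w : Jet 1 := trunc (Nat.le_succ 1) z with hw
    have hx := hasFDerivAt_base 0 w
    have hy := hasFDerivAt_base 1 w
    have hd := fun i : Fin 3 => hasFDerivAt_coord [i] (le_refl 1) w
    have t0 := totalDeriv_eq (i := 0) ((hd 0).add ((hy.const_mul 2).mul (hd 2)))
    have t1 := totalDeriv_eq (i := 1) ((hd 1).sub ((hx.const_mul 2).mul (hd 2)))
    have t2 := totalDeriv_eq (i := 2) ((((((hx.pow 2).add (hy.pow 2)).const_mul 4).mul (hd 2)).add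
      ((hy.const_mul 2).mul (hd 0))).sub ((hx.const_mul 2).mul (hd 1)))
    rw [eulerLagrange, Fin.sum_univ_three, pu, p0, p1, p2]
    refine (congrArg₂ (fun s t => _ - (s + t)) (congrArg₂ (· + ·) t0 t1) t2).trans ?_
    have c1 : ∀ l h, coord w l h = coord z l (h.trans one_le_two) := fun _ _ => rfl
    have c2 : w.1 = z.1 := rfl
    have c3 : ∀ h, trunc h z = w := fun _ => rfl
    have c4 : ∀ i, (shift i z).1 = Pi.single i 1 := fun _ => rfl
    simp only [sub_apply, add_apply, smul_apply, coordL_apply, baseL_apply, smul_eq_mul,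
      coord_shift, c1, c2, c3, c4, equation]
    rw [coord_swap z 2 0, coord_swap z 2 1]
    simp [c2]
    ring
  intro z
  rw [key, neg_eq_zero]

theorem combination_isLiePointSymmetry (a b c r κ : ℝ) :
    IsLiePointSymmetry (equation Real.exp) (combination a b c r κ) :=
  ⟨contDiff_combination a b c r κ, fun z hz => by rw [extend_equation_combination, hz, mul_zero]⟩

theorem combination_isNoetherSymmetry {F : ℝ → ℝ} (hF : ∀ u, HasDerivAt F (Real.exp u) u)
    (a b c r : ℝ) :
    IsNoetherSymmetry (equation Real.exp) (lagrangian F) (combination a b c r 0) := by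
  -- For κ = 0 the left side of the Noether identity is zero, so the zero vector of order m = 0
  -- serves as φ.
  refine ⟨isDerivedFrom_lagrangian hF, combination_isLiePointSymmetry a b c r 0, 0, fun _ _ => 0,
    fun _ => contDiff_const, fun z => ?_⟩
  intro z₁
  rw [noether_combination hF]
  simp [totalDeriv]

theorem mem_generatorsG_iff {S : PointField} :
    S ∈ generatorsG ↔ ∃ a b c r, S = combination a b c r 0 := by
  unfold generatorsG
  simp only [Submodule.mem_span_insert, Submodule.mem_span_singleton, combination_eq, zero_smul,
    add_zero]
  constructor
  · rintro ⟨c, _, ⟨r, _, ⟨a, _, ⟨b, rfl⟩, rfl⟩, rfl⟩, rfl⟩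
    exact ⟨a, b, c, r, by abel⟩
  · rintro ⟨a, b, c, r, rfl⟩
    exact ⟨c, _, ⟨r, _, ⟨a, _, ⟨b, rfl⟩, rfl⟩, rfl⟩, by abel⟩

/-! ### The determining equations -/

/-- The second order jet with the given coordinates. -/
def jetTwo (p : Base) (u d0 d1 d2 h00 h11 h22 h01 h02 h12 : ℝ) : Jet 2 :=
  (p, fun α => match α.1 0, α.1 1, α.1 2 with
    | 0, 0, 0 => u
    | 1, 0, 0 => d0
    | 0, 1, 0 => d1
    | 0, 0, 1 => d2
    | 2, 0, 0 => h00
    | 0, 2, 0 => h11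
    | 0, 0, 2 => h22
    | 1, 1, 0 => h01
    | 1, 0, 1 => h02
    | 0, 1, 1 => h12
    | _, _, _ => 0)

/-- The derivative of `f` in the constant direction `v`. -/
def pd (v : Base × ℝ) (f : Base × ℝ → ℝ) : Base × ℝ → ℝ := fun q => fderiv ℝ f q v

theorem contDiff_pd {f : Base × ℝ → ℝ} (hf : ContDiff ℝ ∞ f) (v : Base × ℝ) :
    ContDiff ℝ ∞ (pd v f) :=
  (hf.fderiv_right (m := ∞) (by simp)).clm_apply contDiff_const

theorem pd_pd_eq {f : Base × ℝ → ℝ} (hf : ContDiff ℝ ∞ f) (v w q : Base × ℝ) :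
    pd v (pd w f) q = fderiv ℝ (fderiv ℝ f) q v w := by
  have hd : Differentiable ℝ (fderiv ℝ f) :=
    (hf.fderiv_right (m := ∞) (by simp)).differentiable (by simp)
  have h := (hd q).hasFDerivAt.clm_apply (hasFDerivAt_const w q)
  unfold pd
  rw [h.fderiv]
  simp

theorem pd_comm {f : Base × ℝ → ℝ} (hf : ContDiff ℝ ∞ f) (v w : Base × ℝ) :
    pd v (pd w f) = pd w (pd v f) := by
  funext q
  rw [pd_pd_eq hf, pd_pd_eq hf]
  exact (hf.contDiffAt.isSymmSndFDerivAt (by simpa using ENat.LEInfty.out)).eq v w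

theorem pd_add_left (v w : Base × ℝ) (f : Base × ℝ → ℝ) (q : Base × ℝ) :
    pd (v + w) f q = pd v f q + pd w f q := map_add _ _ _

theorem pd_smul_left (c : ℝ) (v : Base × ℝ) (f : Base × ℝ → ℝ) (q : Base × ℝ) :
    pd (c • v) f q = c * pd v f q := map_smul _ _ _

/-- The `k`-th base coefficient of a field. -/
def baseCoeff (S : PointField) (k : Fin 3) : Base × ℝ → ℝ := fun q => (S q).1 k

/-- The coefficient of `∂_u` of a field. -/
def fiberCoeff (S : PointField) : Base × ℝ → ℝ := fun q => (S q).2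

theorem contDiff_baseCoeff {S : PointField} (hS : ContDiff ℝ ∞ S) (k : Fin 3) : ContDiff ℝ ∞ (baseCoeff S k) :=
  contDiff_pi.1 hS.fst k

theorem contDiff_fiberCoeff {S : PointField} (hS : ContDiff ℝ ∞ S) : ContDiff ℝ ∞ (fiberCoeff S) := hS.snd

theorem fderiv_fst_eq {S : PointField} (hS : ContDiff ℝ ∞ S) (q v : Base × ℝ) (k : Fin 3) :
    (fderiv ℝ S q v).1 k = pd v (baseCoeff S k) q := by
  have h := ((ContinuousLinearMap.proj (R := ℝ) (φ := fun _ : Fin 3 => ℝ) k).comp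
    (ContinuousLinearMap.fst ℝ Base ℝ)).hasFDerivAt.comp q
    (hS.differentiable (by simp) q).hasFDerivAt
  exact (congrArg (· v) h.fderiv).symm

theorem fderiv_snd_eq {S : PointField} (hS : ContDiff ℝ ∞ S) (q v : Base × ℝ) : (fderiv ℝ S q v).2 = pd v (fiberCoeff S) q := by
  have h := (ContinuousLinearMap.snd ℝ Base ℝ).hasFDerivAt.comp q
    (hS.differentiable (by simp) q).hasFDerivAt
  exact (congrArg (· v) h.fderiv).symm

theorem fderiv_fderiv_fst_eq {S : PointField} (hS : ContDiff ℝ ∞ S) (q v w : Base × ℝ) (k : Fin 3) :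
    (fderiv ℝ (fderiv ℝ S) q v w).1 k = pd v (pd w (baseCoeff S k)) q := by
  have hd : Differentiable ℝ (fderiv ℝ S) :=
    (hS.fderiv_right (m := ∞) (by simp)).differentiable (by simp)
  have h := ((ContinuousLinearMap.proj (R := ℝ) (φ := fun _ : Fin 3 => ℝ) k).comp
    (ContinuousLinearMap.fst ℝ Base ℝ)).hasFDerivAt.comp q
    ((hd q).hasFDerivAt.clm_apply (hasFDerivAt_const w q))
  have e : pd w (baseCoeff S k) = fun q => (fderiv ℝ S q w).1 k :=
    funext fun q => (fderiv_fst_eq hS q w k).symm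
  rw [e]
  refine Eq.trans ?_ (congrArg (· v) h.fderiv).symm
  simp

theorem fderiv_fderiv_snd_eq {S : PointField} (hS : ContDiff ℝ ∞ S) (q v w : Base × ℝ) :
    (fderiv ℝ (fderiv ℝ S) q v w).2 = pd v (pd w (fiberCoeff S)) q := by
  have hd : Differentiable ℝ (fderiv ℝ S) :=
    (hS.fderiv_right (m := ∞) (by simp)).differentiable (by simp)
  have h := (ContinuousLinearMap.snd ℝ Base ℝ).hasFDerivAt.comp q
    ((hd q).hasFDerivAt.clm_apply (hasFDerivAt_const w q))
  have e : pd w (fiberCoeff S) = fun q => (fderiv ℝ S q w).2 :=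
    funext fun q => (fderiv_snd_eq hS q w).symm
  rw [e]
  refine Eq.trans ?_ (congrArg (· v) h.fderiv).symm
  simp

/-- The derivative `∂/∂xⁱ` on `ℝ³ × ℝ`. -/
def dx (i : Fin 3) : (Base × ℝ → ℝ) → Base × ℝ → ℝ := pd (lift i 0)

/-- The derivative `∂/∂u` on `ℝ³ × ℝ`. -/
def du : (Base × ℝ → ℝ) → Base × ℝ → ℝ := pd (0, 1)

theorem lift_eq (i : Fin 3) (c : ℝ) : lift i c = lift i 0 + c • ((0, 1) : Base × ℝ) := by
  simp [lift]

theorem pd_lift (i : Fin 3) (c : ℝ) (f : Base × ℝ → ℝ) (q : Base × ℝ) :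
    pd (lift i c) f q = dx i f q + c * du f q := by
  rw [lift_eq, pd_add_left, pd_smul_left]; rfl

theorem pd_lift_pd_lift {f : Base × ℝ → ℝ} (hf : ContDiff ℝ ∞ f) (i j : Fin 3) (c d : ℝ)
    (q : Base × ℝ) :
    pd (lift i c) (pd (lift j d) f) q
      = dx i (dx j f) q + d * dx i (du f) q + c * dx j (du f) q + c * d * du (du f) q := by
  have h : du (dx j f) = dx j (du f) := pd_comm hf _ _
  rw [← h]
  unfold dx du
  simp only [pd_pd_eq hf, lift_eq i c, lift_eq j d, map_add, map_smul, add_apply, smul_apply,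
    smul_eq_mul]
  ring

/-- The Kohn Laplacian of a function on `ℝ³ × ℝ` in the base variables. -/
def kohn (f : Base × ℝ → ℝ) : Base × ℝ → ℝ := fun q =>
  dx 0 (dx 0 f) q + dx 1 (dx 1 f) q + 4 * (q.1 0 ^ 2 + q.1 1 ^ 2) * dx 2 (dx 2 f) q
    + 4 * q.1 1 * dx 0 (dx 2 f) q - 4 * q.1 0 * dx 1 (dx 2 f) q

/-- The left-invariant derivative `X = ∂_x + 2 y ∂_t`. -/
def dX (f : Base × ℝ → ℝ) : Base × ℝ → ℝ := fun q => dx 0 f q + 2 * q.1 1 * dx 2 f q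

/-- The left-invariant derivative `Y = ∂_y - 2 x ∂_t`. -/
def dY (f : Base × ℝ → ℝ) : Base × ℝ → ℝ := fun q => dx 1 f q - 2 * q.1 0 * dx 2 f q

/-- The second order part `a^{ij} D_i D_j f` without the terms containing `u_{ij}`. -/
def quadPart (f : Base × ℝ → ℝ) (q : Base × ℝ) (d0 d1 d2 : ℝ) : ℝ :=
  kohn f q + 2 * (d0 + 2 * q.1 1 * d2) * dX (du f) q + 2 * (d1 - 2 * q.1 0 * d2) * dY (du f) q
    + ((d0 + 2 * q.1 1 * d2) ^ 2 + (d1 - 2 * q.1 0 * d2) ^ 2) * du (du f) q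

/-- On the solution set u_xx is a function of the other jet coordinates, which are free. This is the
symmetry condition there, with the u_ij-terms carrying η_u and ξ^k_u contracted to -e^u. Keeping
`h00` as a variable lets it be supplied by `_ rfl`. -/
theorem lie_identity {S : PointField} (h : IsLiePointSymmetry (equation Real.exp) S)
    (q : Base × ℝ) (d0 d1 d2 h11 h22 h01 h02 h12 : ℝ) :
    ∀ h00, h00 = -(h11 + 4 * (q.1 0 ^ 2 + q.1 1 ^ 2) * h22 + 4 * q.1 1 * h02 - 4 * q.1 0 * h12
      + Real.exp q.2) →
    quadPart (fiberCoeff S) q d0 d1 d2 - Real.exp q.2 * du (fiberCoeff S) q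
      - (quadPart (baseCoeff S 0) q d0 d1 d2 - Real.exp q.2 * du (baseCoeff S 0) q) * d0
      - (quadPart (baseCoeff S 1) q d0 d1 d2 - Real.exp q.2 * du (baseCoeff S 1) q) * d1
      - (quadPart (baseCoeff S 2) q d0 d1 d2 - Real.exp q.2 * du (baseCoeff S 2) q) * d2
      - 2 * ((dX (baseCoeff S 0) q + (d0 + 2 * q.1 1 * d2) * du (baseCoeff S 0) q)
            * h00
          + (dX (baseCoeff S 1) q + (d0 + 2 * q.1 1 * d2) * du (baseCoeff S 1) q) * h01
          + (dX (baseCoeff S 2) q + (d0 + 2 * q.1 1 * d2) * du (baseCoeff S 2) q) * h02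
          + (dY (baseCoeff S 0) q + (d1 - 2 * q.1 0 * d2) * du (baseCoeff S 0) q) * h01
          + (dY (baseCoeff S 1) q + (d1 - 2 * q.1 0 * d2) * du (baseCoeff S 1) q) * h11
          + (dY (baseCoeff S 2) q + (d1 - 2 * q.1 0 * d2) * du (baseCoeff S 2) q) * h12
          + (2 * q.1 1 * (dX (baseCoeff S 0) q + (d0 + 2 * q.1 1 * d2) * du (baseCoeff S 0) q)
            - 2 * q.1 0 * (dY (baseCoeff S 0) q + (d1 - 2 * q.1 0 * d2) * du (baseCoeff S 0) q))
            * h02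
          + (2 * q.1 1 * (dX (baseCoeff S 1) q + (d0 + 2 * q.1 1 * d2) * du (baseCoeff S 1) q)
            - 2 * q.1 0 * (dY (baseCoeff S 1) q + (d1 - 2 * q.1 0 * d2) * du (baseCoeff S 1) q))
            * h12
          + (2 * q.1 1 * (dX (baseCoeff S 2) q + (d0 + 2 * q.1 1 * d2) * du (baseCoeff S 2) q)
            - 2 * q.1 0 * (dY (baseCoeff S 2) q + (d1 - 2 * q.1 0 * d2) * du (baseCoeff S 2) q))
            * h22)
      + 8 * (q.1 0 * baseCoeff S 0 q + q.1 1 * baseCoeff S 1 q) * h22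
      + 4 * baseCoeff S 1 q * h02 - 4 * baseCoeff S 0 q * h12
      + Real.exp q.2 * fiberCoeff S q = 0 := by
  intro h00 hh
  obtain ⟨hS, h⟩ := h
  obtain ⟨p, u⟩ := q
  simp only at hh
  set z := jetTwo p u d0 d1 d2 h00 h11 h22 h01 h02 h12 with hz
  have cp : point z = (p, u) := rfl
  have c : z.1 = p := rfl
  have cu : coord z [] (Nat.zero_le 2) = u := rfl
  have c0 : coord z [0] one_le_two = d0 := rfl
  have c1 : coord z [1] one_le_two = d1 := rfl
  have c2 : coord z [2] one_le_two = d2 := rfl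
  have c00 : coord z [0, 0] (le_refl 2) = h00 := rfl
  have c11 : coord z [1, 1] (le_refl 2) = h11 := rfl
  have c22 : coord z [2, 2] (le_refl 2) = h22 := rfl
  have c01 : coord z [0, 1] (le_refl 2) = h01 := rfl
  have c02 : coord z [0, 2] (le_refl 2) = h02 := rfl
  have c12 : coord z [1, 2] (le_refl 2) = h12 := rfl
  have c10 : coord z [1, 0] (le_refl 2) = h01 := rfl
  have c20 : coord z [2, 0] (le_refl 2) = h02 := rfl
  have c21 : coord z [2, 1] (le_refl 2) = h12 := rfl
  have h0 : equation Real.exp z = 0 := by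
    simp only [equation, c, cu, c00, c11, c22, c02, c12, hh]
    ring
  have key := h z h0
  rw [extend_equation] at key
  simp only [extCoeff_pair hS, Fin.sum_univ_three, fderiv_fderiv_fst_eq hS,
    fderiv_fderiv_snd_eq hS, fderiv_fst_eq hS, fderiv_snd_eq hS,
    pd_lift_pd_lift (contDiff_baseCoeff hS _), pd_lift_pd_lift (contDiff_fiberCoeff hS),
    pd_lift, cp, c, cu, c0, c1, c2, c00, c11, c22, c01, c02, c12, c10, c20, c21] at key
  have s0 : ∀ k, (S (p, u)).1 k = baseCoeff S k (p, u) := fun _ => rfl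
  have s1 : (S (p, u)).2 = fiberCoeff S (p, u) := rfl
  have s2 : ∀ f, pd (0, 1) f (p, u) = du f (p, u) := fun _ => rfl
  simp only [s0, s1, s2] at key
  unfold quadPart kohn dX dY
  simp only
  -- Eliminating e^u by means of the equation makes the remaining comparison purely polynomial.
  have he : Real.exp u = -(h00 + h11 + 4 * (p 0 ^ 2 + p 1 ^ 2) * h22 + 4 * p 1 * h02
      - 4 * p 0 * h12) := by rw [hh]; ring
  rw [he] at key ⊢
  linear_combination key

/-- The derivatives ξ^k_u are the coefficients of products of a first and a second derivative of u.
Mixed second differences of `lie_identity` isolate these products. -/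
theorem du_baseCoeff {S : PointField} (h : IsLiePointSymmetry (equation Real.exp) S)
    (k : Fin 3) (q : Base × ℝ) : du (baseCoeff S k) q = 0 := by
  have key := lie_identity h q
  unfold quadPart at key
  have e0 : du (baseCoeff S 0) q = 0 := by
    linear_combination (-1 / 2) * (key 1 0 0 (-1) 0 0 0 0 _ rfl - key 0 0 0 (-1) 0 0 0 0 _ rfl
      - key 1 0 0 0 0 0 0 0 _ rfl + key 0 0 0 0 0 0 0 0 _ rfl)
  have e1 : du (baseCoeff S 1) q = 0 := by
    linear_combination (1 / 2) * (key 0 1 0 (-1) 0 0 0 0 _ rfl - key 0 0 0 (-1) 0 0 0 0 _ rfl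
      - key 0 1 0 0 0 0 0 0 _ rfl + key 0 0 0 0 0 0 0 0 _ rfl)
  have e2 : du (baseCoeff S 2) q = 0 := by
    linear_combination (-1 / 2) * (key 1 0 0 0 0 (2 * q.1 0) 1 0 _ rfl
      - key 0 0 0 0 0 (2 * q.1 0) 1 0 _ rfl
      - key 1 0 0 0 0 0 0 0 _ rfl + key 0 0 0 0 0 0 0 0 _ rfl)
      + 2 * q.1 1 * e0 - 2 * q.1 0 * e1
  fin_cases k <;> assumption

/-- With ξ^k_u = 0 the identity is linear in the second derivatives and quadratic in the first. The
first two equations are conformality in the frame X, Y; the next two say that S preserves the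
contact distribution spanned by X and Y. -/
theorem determining_equations {S : PointField} (h : IsLiePointSymmetry (equation Real.exp) S)
    (q : Base × ℝ) :
    dX (baseCoeff S 0) q = dY (baseCoeff S 1) q ∧
    dX (baseCoeff S 1) q = -dY (baseCoeff S 0) q ∧
    dX (baseCoeff S 2) q - 2 * q.1 1 * dX (baseCoeff S 0) q + 2 * q.1 0 * dX (baseCoeff S 1) q
      = 2 * baseCoeff S 1 q ∧
    dY (baseCoeff S 2) q - 2 * q.1 1 * dY (baseCoeff S 0) q + 2 * q.1 0 * dY (baseCoeff S 1) q
      = -2 * baseCoeff S 0 q ∧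
    du (du (fiberCoeff S)) q = 0 ∧
    kohn (baseCoeff S 0) q = 2 * dX (du (fiberCoeff S)) q ∧
    kohn (baseCoeff S 1) q = 2 * dY (du (fiberCoeff S)) q ∧
    kohn (fiberCoeff S) q + Real.exp q.2 * (fiberCoeff S q - du (fiberCoeff S) q
      + 2 * dX (baseCoeff S 0) q) = 0 := by
  have key := lie_identity h q
  have z : ∀ k, du (baseCoeff S k) = fun _ => 0 := fun k => funext (du_baseCoeff h k)
  have zd : du (fun _ => 0) q = 0 := by simp [du, pd]
  have zX : dX (fun _ => 0) q = 0 := by simp [dX, dx, pd]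
  have zY : dY (fun _ => 0) q = 0 := by simp [dY, dx, pd]
  simp only [quadPart, z, zd, zX, zY] at key
  have a0 := key 0 0 0 0 0 0 0 0 _ rfl
  refine ⟨?_, ?_, ?_, ?_, ?_, ?_, ?_, ?_⟩
  · linear_combination (-1 / 2) * (key 0 0 0 (-1) 0 0 0 0 _ rfl - a0)
  · linear_combination (-1 / 2) * (key 0 0 0 0 0 1 0 0 _ rfl - a0)
  -- In the frame X, Y, ∂_t these second derivatives differ from those of `a0` only by X∂_t u = 1;
  -- in the next line, only by Y∂_t u = 1.
  · linear_combination (-1 / 2) * (key 0 0 0 0 0 (2 * q.1 0) 1 0 _ rfl - a0)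
  · linear_combination (-1 / 2) * (key 0 0 0 (4 * q.1 0) 0 (-2 * q.1 1) 0 1 _ rfl - a0)
  -- The even part in u_x gives η_uu; the odd parts in u_x and u_y give the two equations after it.
  · linear_combination (1 / 2) * (key 1 0 0 0 0 0 0 0 _ rfl + key (-1) 0 0 0 0 0 0 0 _ rfl - 2 * a0)
  · linear_combination (-1 / 2) * (key 1 0 0 0 0 0 0 0 _ rfl - key (-1) 0 0 0 0 0 0 0 _ rfl)
  · linear_combination (-1 / 2) * (key 0 1 0 0 0 0 0 0 _ rfl - key 0 (-1) 0 0 0 0 0 0 _ rfl)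
  · linear_combination a0

/-! ### Dependence of the coefficients on u. -/

theorem hasDerivAt_fiber {f : Base × ℝ → ℝ} (hf : ContDiff ℝ ∞ f) (p : Base) (u : ℝ) :
    HasDerivAt (fun u => f (p, u)) (du f (p, u)) u :=
  (hf.differentiable (by simp) (p, u)).hasFDerivAt.comp_hasDerivAt u
    ((hasDerivAt_const u p).prodMk (hasDerivAt_id u))

theorem eq_of_du_eq_zero {f : Base × ℝ → ℝ} (hf : ContDiff ℝ ∞ f) (h : ∀ q, du f q = 0)
    (p : Base) (u v : ℝ) : f (p, u) = f (p, v) :=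
  is_const_of_deriv_eq_zero (fun u => (hasDerivAt_fiber hf p u).differentiableAt)
    (fun u => (hasDerivAt_fiber hf p u).deriv.trans (h _)) u v

theorem affine_of_du_du_eq_zero {f : Base × ℝ → ℝ} (hf : ContDiff ℝ ∞ f)
    (h : ∀ q, du (du f) q = 0) (p : Base) (u : ℝ) : f (p, u) = f (p, 0) + u * du f (p, 0) := by
  have h1 := fun u => eq_of_du_eq_zero (contDiff_pd hf (0, 1)) h p u 0
  have h2 : ∀ u, HasDerivAt (fun u => f (p, u) - u * du f (p, 0)) 0 u := fun u => by
    have := (hasDerivAt_fiber hf p u).sub ((hasDerivAt_id u).mul_const (du f (p, 0)))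
    have e : du f (p, u) = du f (p, 0) := h1 u
    rw [e, one_mul, sub_self] at this
    exact this
  have := is_const_of_deriv_eq_zero (fun u => (h2 u).differentiableAt) (fun u => (h2 u).deriv) u 0
  simp only [zero_mul, sub_zero] at this
  linarith

theorem du_dx {f : Base × ℝ → ℝ} (hf : ContDiff ℝ ∞ f) (i : Fin 3) :
    du (dx i f) = dx i (du f) := pd_comm hf _ _

theorem contDiff_dx {f : Base × ℝ → ℝ} (hf : ContDiff ℝ ∞ f) (i : Fin 3) :
    ContDiff ℝ ∞ (dx i f) := contDiff_pd hf _

theorem contDiff_du {f : Base × ℝ → ℝ} (hf : ContDiff ℝ ∞ f) : ContDiff ℝ ∞ (du f) :=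
  contDiff_pd hf _

theorem dx_zero (i : Fin 3) : dx i (fun _ => 0) = fun _ => 0 := by
  funext q; simp [dx, pd]

theorem kohn_affine {f : Base × ℝ → ℝ} (hf : ContDiff ℝ ∞ f)
    (h : ∀ q, du (du f) q = 0) (p : Base) : ∃ a b : ℝ, ∀ u, kohn f (p, u) = a * u + b := by
  have h0 : du (du f) = fun _ => 0 := funext h
  have key : ∀ i j u, dx i (dx j f) (p, u)
      = dx i (dx j f) (p, 0) + u * du (dx i (dx j f)) (p, 0) := fun i j =>
    affine_of_du_du_eq_zero (contDiff_dx (contDiff_dx hf j) i) (fun q => by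
      rw [du_dx (contDiff_dx hf j), du_dx hf, du_dx (contDiff_dx (contDiff_du hf) j),
        du_dx (contDiff_du hf), h0, dx_zero, dx_zero]) p
  refine ⟨du (dx 0 (dx 0 f)) (p, 0) + du (dx 1 (dx 1 f)) (p, 0)
      + 4 * (p 0 ^ 2 + p 1 ^ 2) * du (dx 2 (dx 2 f)) (p, 0)
      + 4 * p 1 * du (dx 0 (dx 2 f)) (p, 0) - 4 * p 0 * du (dx 1 (dx 2 f)) (p, 0),
    kohn f (p, 0), fun u => ?_⟩
  unfold kohn
  rw [key 0 0, key 1 1, key 2 2, key 0 2, key 1 2]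
  ring

theorem eq_zero_of_affine_add_affine_mul_exp {a b c d : ℝ}
    (h : ∀ u : ℝ, a * u + b + (c * u + d) * Real.exp u = 0) : c = 0 ∧ d = 0 := by
  set e := Real.exp 1 with he
  have e1 : 0 < (e - 1) ^ 2 := by
    have : (1 : ℝ) + 1 < Real.exp 1 := Real.add_one_lt_exp one_ne_zero
    have : 0 < e - 1 := by linarith
    positivity
  have e2 : Real.exp 2 = e ^ 2 := by rw [he, ← Real.exp_nat_mul]; norm_num
  have e3 : Real.exp 3 = e ^ 3 := by rw [he, ← Real.exp_nat_mul]; norm_num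
  have h0 := h 0
  have h1 := h 1
  have h2 := h 2
  have h3 := h 3
  rw [Real.exp_zero] at h0
  rw [e2] at h2
  rw [e3] at h3
  rw [← he] at h1
  have epos : 0 < e := Real.exp_pos 1
  -- Second differences over 0, 1, 2 and over 1, 2, 3 remove a u + b; subtracting the two results
  -- leaves c (e - 1)² = 0.
  have s0 : (2 * c + d) * e ^ 2 - 2 * (c + d) * e + d = 0 := by linear_combination h0 - 2 * h1 + h2
  have s1 : e * ((3 * c + d) * e ^ 2 - 2 * (2 * c + d) * e + (c + d)) = 0 := by
    linear_combination h1 - 2 * h2 + h3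
  have s2 := (mul_eq_zero.1 s1).resolve_left epos.ne'
  have hc : c = 0 := by
    have : c * (e - 1) ^ 2 = 0 := by linear_combination s2 - s0
    exact (mul_eq_zero.1 this).resolve_right e1.ne'
  refine ⟨hc, ?_⟩
  have : d * (e - 1) ^ 2 = 0 := by rw [hc] at s0; linear_combination s0
  exact (mul_eq_zero.1 this).resolve_right e1.ne'

/-- Over a fixed base point, Δη and η - η_u + 2Xξ^1 are affine in u, so the last determining
equation forces the factor of e^u to vanish. Its slope is η_u; its constant term then gives η. -/
theorem fiberCoeff_eq {S : PointField} (h : IsLiePointSymmetry (equation Real.exp) S)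
    (q : Base × ℝ) :
    du (fiberCoeff S) q = 0 ∧ fiberCoeff S q = -2 * dX (baseCoeff S 0) q := by
  obtain ⟨p, v⟩ := q
  have hf := contDiff_fiberCoeff h.1
  have hb := contDiff_baseCoeff h.1 0
  have h2 : ∀ q, du (du (fiberCoeff S)) q = 0 := fun q => (determining_equations h q).2.2.2.2.1
  have hu : ∀ u, du (fiberCoeff S) (p, u) = du (fiberCoeff S) (p, 0) := fun u =>
    eq_of_du_eq_zero (contDiff_du hf) h2 p u 0
  have hx : ∀ i u, dx i (baseCoeff S 0) (p, u) = dx i (baseCoeff S 0) (p, 0) := fun i u =>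
    eq_of_du_eq_zero (contDiff_dx hb i) (fun q => by
      rw [du_dx hb, funext (du_baseCoeff h 0), dx_zero]) p u 0
  have hX : ∀ u, dX (baseCoeff S 0) (p, u) = dX (baseCoeff S 0) (p, 0) := fun u => by
    simp only [dX, hx _ u]
  obtain ⟨a, b, hk⟩ := kohn_affine hf h2 p
  have key : ∀ u : ℝ, a * u + b + (du (fiberCoeff S) (p, 0) * u + (fiberCoeff S (p, 0)
      - du (fiberCoeff S) (p, 0) + 2 * dX (baseCoeff S 0) (p, 0))) * Real.exp u = 0 := fun u => by
    have e := (determining_equations h (p, u)).2.2.2.2.2.2.2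
    rw [hk, hu, hX, affine_of_du_du_eq_zero hf h2] at e
    linear_combination e
  obtain ⟨hc, hd⟩ := eq_zero_of_affine_add_affine_mul_exp key
  rw [hc] at hd
  refine ⟨(hu v).trans hc, ?_⟩
  rw [affine_of_du_du_eq_zero hf h2 p v, hX, hc]
  linarith

/-! ### Solution of the determining equations -/

theorem dx_add {f g : Base × ℝ → ℝ} (hf : ContDiff ℝ ∞ f) (hg : ContDiff ℝ ∞ g) (i : Fin 3)
    (q : Base × ℝ) : dx i (fun q => f q + g q) q = dx i f q + dx i g q := by
  have h := (hf.differentiable (by simp) q).hasFDerivAt.add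
    (hg.differentiable (by simp) q).hasFDerivAt
  exact congrArg (· (lift i 0)) h.fderiv

theorem dx_const_mul {f : Base × ℝ → ℝ} (hf : ContDiff ℝ ∞ f) (c : ℝ) (i : Fin 3)
    (q : Base × ℝ) : dx i (fun q => c * f q) q = c * dx i f q := by
  have h := (hf.differentiable (by simp) q).hasFDerivAt.const_mul c
  exact congrArg (· (lift i 0)) h.fderiv

theorem contDiff_coord_mul {f : Base × ℝ → ℝ} (hf : ContDiff ℝ ∞ f) (c : ℝ) (j : Fin 3) :
    ContDiff ℝ ∞ (fun q : Base × ℝ => c * q.1 j * f q) :=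
  (contDiff_const.mul (contDiff_pi.1 contDiff_fst j)).mul hf

theorem dx_coord_mul {f : Base × ℝ → ℝ} (hf : ContDiff ℝ ∞ f) (c : ℝ) (i j : Fin 3)
    (q : Base × ℝ) : dx i (fun q => c * q.1 j * f q) q
      = (if j = i then c * f q else 0) + c * q.1 j * dx i f q := by
  have h1 : HasFDerivAt (fun q : Base × ℝ => q.1 j)
      ((ContinuousLinearMap.proj (R := ℝ) (φ := fun _ : Fin 3 => ℝ) j).comp
        (ContinuousLinearMap.fst ℝ Base ℝ)) q :=
    ((ContinuousLinearMap.proj (R := ℝ) (φ := fun _ : Fin 3 => ℝ) j).comp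
      (ContinuousLinearMap.fst ℝ Base ℝ)).hasFDerivAt
  have h := (h1.const_mul c).mul (hf.differentiable (by simp) q).hasFDerivAt
  refine (congrArg (· (lift i 0)) h.fderiv).trans ?_
  simp only [add_apply, smul_apply, smul_eq_mul, dx, pd, lift,
    ContinuousLinearMap.comp_apply, ContinuousLinearMap.proj_apply, ContinuousLinearMap.coe_fst',
    Pi.single_apply]
  split_ifs <;> ring

theorem dX_eq (f : Base × ℝ → ℝ) : dX f = fun q => dx 0 f q + 2 * q.1 1 * dx 2 f q := rfl

theorem dY_eq (f : Base × ℝ → ℝ) : dY f = fun q => dx 1 f q + (-2) * q.1 0 * dx 2 f q := by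
  funext q; unfold dY; ring

theorem contDiff_dX {f : Base × ℝ → ℝ} (hf : ContDiff ℝ ∞ f) : ContDiff ℝ ∞ (dX f) :=
  (contDiff_dx hf 0).add (contDiff_coord_mul (contDiff_dx hf 2) 2 1)

theorem contDiff_dY {f : Base × ℝ → ℝ} (hf : ContDiff ℝ ∞ f) : ContDiff ℝ ∞ (dY f) := by
  rw [dY_eq]
  exact (contDiff_dx hf 1).add (contDiff_coord_mul (contDiff_dx hf 2) (-2) 0)

theorem dx_dX {f : Base × ℝ → ℝ} (hf : ContDiff ℝ ∞ f) (i : Fin 3) (q : Base × ℝ) :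
    dx i (dX f) q = dx i (dx 0 f) q + ((if 1 = i then 2 * dx 2 f q else 0)
      + 2 * q.1 1 * dx i (dx 2 f) q) := by
  rw [dX_eq, dx_add (contDiff_dx hf 0) (contDiff_coord_mul (contDiff_dx hf 2) 2 1),
    dx_coord_mul (contDiff_dx hf 2)]

theorem dx_dY {f : Base × ℝ → ℝ} (hf : ContDiff ℝ ∞ f) (i : Fin 3) (q : Base × ℝ) :
    dx i (dY f) q = dx i (dx 1 f) q + ((if 0 = i then (-2) * dx 2 f q else 0)
      + (-2) * q.1 0 * dx i (dx 2 f) q) := by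
  rw [dY_eq, dx_add (contDiff_dx hf 1) (contDiff_coord_mul (contDiff_dx hf 2) (-2) 0),
    dx_coord_mul (contDiff_dx hf 2)]

theorem dx_comm {f : Base × ℝ → ℝ} (hf : ContDiff ℝ ∞ f) (i j : Fin 3) :
    dx i (dx j f) = dx j (dx i f) := pd_comm hf _ _

theorem dX_dY_sub_dY_dX {f : Base × ℝ → ℝ} (hf : ContDiff ℝ ∞ f) (q : Base × ℝ) :
    dX (dY f) q - dY (dX f) q = -4 * dx 2 f q := by
  rw [dX, dY, dx_dX hf, dx_dX hf, dx_dY hf, dx_dY hf, dx_comm hf 1 0, dx_comm hf 2 0,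
    dx_comm hf 2 1]
  simp
  ring

theorem kohn_eq {f : Base × ℝ → ℝ} (hf : ContDiff ℝ ∞ f) (q : Base × ℝ) :
    kohn f q = dX (dX f) q + dY (dY f) q := by
  rw [dX, dY, dx_dX hf, dx_dX hf, dx_dY hf, dx_dY hf, dx_comm hf 2 0, dx_comm hf 2 1, kohn]
  simp
  ring

theorem dx_two_dX {f : Base × ℝ → ℝ} (hf : ContDiff ℝ ∞ f) (q : Base × ℝ) :
    dx 2 (dX f) q = dX (dx 2 f) q := by
  rw [dx_dX hf, dX, dx_comm hf 2 0]
  simp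

theorem dx_two_dY {f : Base × ℝ → ℝ} (hf : ContDiff ℝ ∞ f) (q : Base × ℝ) :
    dx 2 (dY f) q = dY (dx 2 f) q := by
  rw [dx_dY hf, dY, dx_comm hf 2 1]
  simp
  ring

theorem dX_const_mul {f : Base × ℝ → ℝ} (hf : ContDiff ℝ ∞ f) (c : ℝ) (q : Base × ℝ) :
    dX (fun q => c * f q) q = c * dX f q := by
  rw [dX, dX, dx_const_mul hf, dx_const_mul hf]; ring

theorem dY_const_mul {f : Base × ℝ → ℝ} (hf : ContDiff ℝ ∞ f) (c : ℝ) (q : Base × ℝ) :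
    dY (fun q => c * f q) q = c * dY f q := by
  rw [dY, dY, dx_const_mul hf, dx_const_mul hf]; ring

theorem eq_of_dx_eq_const {f : Base × ℝ → ℝ} (hf : ContDiff ℝ ∞ f) (hu : ∀ q, du f q = 0)
    {a b c : ℝ} (h0 : ∀ q, dx 0 f q = a) (h1 : ∀ q, dx 1 f q = b) (h2 : ∀ q, dx 2 f q = c)
    (q : Base × ℝ) : f q = f 0 + a * q.1 0 + b * q.1 1 + c * q.1 2 := by
  have hd := hf.differentiable (by simp)
  have dec : ∀ v : Base × ℝ, v = v.1 0 • lift 0 0 + v.1 1 • lift 1 0 + v.1 2 • lift 2 0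
      + v.2 • ((0, 1) : Base × ℝ) := by
    intro v
    refine Prod.ext (funext fun i => ?_) (by simp [lift])
    fin_cases i <;> simp [lift]
  have hv : ∀ p v, fderiv ℝ f p v = a * v.1 0 + b * v.1 1 + c * v.1 2 := by
    intro p v
    have e0 : fderiv ℝ f p (lift 0 0) = a := h0 p
    have e1 : fderiv ℝ f p (lift 1 0) = b := h1 p
    have e2 : fderiv ℝ f p (lift 2 0) = c := h2 p
    have e3 : fderiv ℝ f p (0, 1) = 0 := hu p
    conv_lhs => rw [dec v]
    simp only [map_add, map_smul, e0, e1, e2, e3, smul_eq_mul]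
    ring
  have hconst : ∀ p, fderiv ℝ (fun q => f q - fderiv ℝ f 0 q) p = 0 := by
    intro p
    rw [((hd p).hasFDerivAt.fun_sub (fderiv ℝ f 0).hasFDerivAt).fderiv]
    refine ContinuousLinearMap.ext fun v => ?_
    simp only [sub_apply, hv, sub_self, zero_apply]
  have := is_const_of_fderiv_eq_zero (𝕜 := ℝ)
    (fun p => ((hd p).hasFDerivAt.fun_sub (fderiv ℝ f 0).hasFDerivAt).differentiableAt) hconst q 0
  simp only [hv, Prod.fst_zero, Pi.zero_apply] at this
  linarith

/-- X and Y generate all base directions: their commutator gives f_t = 0, and then f_x = f_y = 0. -/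
theorem eq_of_dX_eq_zero {f : Base × ℝ → ℝ} (hf : ContDiff ℝ ∞ f) (hu : ∀ q, du f q = 0)
    (hX : ∀ q, dX f q = 0) (hY : ∀ q, dY f q = 0) (q : Base × ℝ) : f q = f 0 := by
  have hT : ∀ q, dx 2 f q = 0 := fun q => by
    have h := dX_dY_sub_dY_dX hf q
    have eX : dX f = fun _ => 0 := funext hX
    have eY : dY f = fun _ => 0 := funext hY
    rw [eX, eY, dX, dY] at h
    simp only [dx_zero] at h
    linarith
  have h := eq_of_dx_eq_const hf hu (a := 0) (b := 0) (c := 0)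
    (fun q => by have := hX q; rw [dX, hT] at this; linarith)
    (fun q => by have := hY q; rw [dY, hT] at this; linarith) hT q
  linarith

theorem eq_combination_of_isLiePointSymmetry {S : PointField}
    (h : IsLiePointSymmetry (equation Real.exp) S) :
    ∃ a b c r κ, S = combination a b c r κ := by
  have hS := h.1
  set A := baseCoeff S 0 with hA
  set B := baseCoeff S 1 with hB
  set Z := baseCoeff S 2 with hZ
  have sA : ContDiff ℝ ∞ A := contDiff_baseCoeff hS 0
  have sB : ContDiff ℝ ∞ B := contDiff_baseCoeff hS 1
  have sZ : ContDiff ℝ ∞ Z := contDiff_baseCoeff hS 2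
  have uA : ∀ q, du A q = 0 := du_baseCoeff h 0
  have uB : ∀ q, du B q = 0 := du_baseCoeff h 1
  have uZ : ∀ q, du Z q = 0 := du_baseCoeff h 2
  have uη : du (fiberCoeff S) = fun _ => 0 := funext fun q => (fiberCoeff_eq h q).1
  have det := determining_equations h
  simp only [← hA, ← hB, ← hZ, uη] at det
  have XA : dX A = dY B := funext fun q => (det q).1
  have YA : dY A = fun q => (-1) * dX B q := funext fun q => by linarith [(det q).2.1]
  have XB : dX B = fun q => (-1) * dY A q := funext fun q => by linarith [(det q).2.1]
  have XZ := fun q => (det q).2.2.1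
  have YZ := fun q => (det q).2.2.2.1
  have zX : ∀ q, dX (fun _ => 0) q = 0 := fun q => by simp [dX, dx_zero]
  have zY : ∀ q, dY (fun _ => 0) q = 0 := fun q => by simp [dY, dx_zero]
  have kA : ∀ q, dX (dX A) q + dY (dY A) q = 0 := fun q => by
    rw [← kohn_eq sA, (det q).2.2.2.2.2.1, zX, mul_zero]
  have kB : ∀ q, dX (dX B) q + dY (dY B) q = 0 := fun q => by
    rw [← kohn_eq sB, (det q).2.2.2.2.2.2.1, zY, mul_zero]
  -- By the conformality equations [X,Y]A = -X²B - Y²B, which is zero since B is Kohn-harmonic;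
  -- symmetrically for B.
  have TA : ∀ q, dx 2 A q = 0 := fun q => by
    have e := dX_dY_sub_dY_dX sA q
    rw [YA, XA, dX_const_mul (contDiff_dX sB)] at e
    linarith [kB q]
  have TB : ∀ q, dx 2 B q = 0 := fun q => by
    have e := dX_dY_sub_dY_dX sB q
    rw [← XA, XB, dY_const_mul (contDiff_dY sA)] at e
    linarith [kA q]
  -- The contact Hamiltonian: the contact form dt - 2y dx + 2x dy, which annihilates X and Y,
  -- evaluated on the base part of S.
  set C : Base × ℝ → ℝ := fun q => Z q + ((-2) * q.1 1 * A q + 2 * q.1 0 * B q) with hC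
  have s1 := contDiff_coord_mul sA (-2) 1
  have s2 := contDiff_coord_mul sB 2 0
  have sC : ContDiff ℝ ∞ C := sZ.add (s1.add s2)
  have dC : ∀ i q, dx i C q = dx i Z q + (((if 1 = i then (-2) * A q else 0)
      + (-2) * q.1 1 * dx i A q) + ((if 0 = i then 2 * B q else 0) + 2 * q.1 0 * dx i B q)) := by
    intro i q
    rw [hC, dx_add sZ (s1.add s2), dx_add s1 s2, dx_coord_mul sA, dx_coord_mul sB]
  have XC : dX C = fun q => 4 * B q := funext fun q => by
    have e := XZ q
    rw [dX] at e ⊢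
    rw [dC, dC]
    simp only [dX] at e
    simp
    linarith
  have YC : dY C = fun q => (-4) * A q := funext fun q => by
    have e := YZ q
    rw [dY] at e ⊢
    rw [dC, dC]
    simp only [dY] at e
    simp
    linarith
  have TC : ∀ q, dx 2 C q = 2 * dX A q := fun q => by
    have e := dX_dY_sub_dY_dX sC q
    rw [XC, YC, dX_const_mul sA, dY_const_mul sB, ← XA] at e
    linarith
  have TC' : dx 2 C = fun q => 2 * dX A q := funext TC
  have sm := contDiff_dX sA
  have sw := contDiff_dX sB
  -- As ∂_t commutes with X and Y, 2X(XA) = X∂_t C = ∂_t XC = 4∂_t B = 0, and likewise 2Y(XA) =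
  -- -4∂_t A = 0.
  have Xm : ∀ q, dX (dX A) q = 0 := fun q => by
    have e := dx_two_dX sC q
    rw [TC', dX_const_mul sm, XC, dx_const_mul sB, TB] at e
    linarith
  have Ym : ∀ q, dY (dX A) q = 0 := fun q => by
    have e := dx_two_dY sC q
    rw [TC', dY_const_mul sm, YC, dx_const_mul sA, TA] at e
    linarith
  have Xw : ∀ q, dX (dX B) q = 0 := fun q => by
    have e := kB q
    rw [← XA, Ym] at e
    linarith
  have Yw : ∀ q, dY (dX B) q = 0 := fun q => by
    rw [XB, dY_const_mul (contDiff_dY sA)]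
    linarith [kA q, Xm q]
  have eA : dX A = dx 0 A := funext fun q => by rw [dX, TA]; ring
  have eB : dX B = dx 0 B := funext fun q => by rw [dX, TB]; ring
  have eA' : ∀ q, dY A q = dx 1 A q := fun q => by rw [dY, TA]; ring
  have eB' : ∀ q, dY B q = dx 1 B q := fun q => by rw [dY, TB]; ring
  have um : ∀ q, du (dX A) q = 0 := fun q => by
    rw [eA, du_dx sA, funext uA, dx_zero]
  have uw : ∀ q, du (dX B) q = 0 := fun q => by
    rw [eB, du_dx sB, funext uB, dx_zero]
  have cm : ∀ q, dX A q = dX A 0 := eq_of_dX_eq_zero sm um Xm Ym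
  have cw : ∀ q, dX B q = dX B 0 := eq_of_dX_eq_zero sw uw Xw Yw
  set m := dX A 0 with hm
  set w := dX B 0 with hw
  have A0 : ∀ q, dx 0 A q = m := fun q => by rw [← eA, cm]
  have A1 : ∀ q, dx 1 A q = -w := fun q => by rw [← eA', YA]; simp only [cw]; ring
  have B0 : ∀ q, dx 0 B q = w := fun q => by rw [← eB, cw]
  have B1 : ∀ q, dx 1 B q = m := fun q => by rw [← eB', ← XA, cm]
  have fA := eq_of_dx_eq_const sA uA A0 A1 TA
  have fB := eq_of_dx_eq_const sB uB B0 B1 TB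
  have Z2 : ∀ q, dx 2 Z q = 2 * m := fun q => by
    have e := TC q
    rw [dC, TA, TB, cm] at e
    simpa using e
  have Z0 : ∀ q, dx 0 Z q = 2 * B 0 := fun q => by
    have e := XZ q
    rw [dX, Z2, cm, cw, fB q] at e
    linarith
  have Z1 : ∀ q, dx 1 Z q = -2 * A 0 := fun q => by
    have e := YZ q
    rw [dY, Z2, eA', A1, eB', B1, fA q] at e
    linarith
  have fZ := eq_of_dx_eq_const sZ uZ Z0 Z1 Z2
  refine ⟨A 0, B 0, Z 0, -w, m, funext fun q => Prod.ext (funext fun i => ?_) ?_⟩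
  · fin_cases i
    · exact (fA q).trans (by simp [combination]; ring)
    · exact (fB q).trans (by simp [combination])
    · exact (fZ q).trans (by simp [combination]; ring)
  · refine (fiberCoeff_eq h q).2.trans ?_
    rw [← hA, cm]
    rfl

/-! ### Integrals of total divergences -/

/-- The `m`-jet of the function `p ↦ s * g (p 0) * g (p 1) * g (p 2)`. -/
def prolong (s : ℝ) (g : ℝ → ℝ) (m : ℕ) (p : Base) : Jet m :=
  (p, fun α => s * (iteratedDeriv (α.1 0) g (p 0) * iteratedDeriv (α.1 1) g (p 1)
    * iteratedDeriv (α.1 2) g (p 2)))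

theorem contDiff_iteratedDeriv {g : ℝ → ℝ} (hg : ContDiff ℝ ∞ g) (n : ℕ) :
    ContDiff ℝ ∞ (iteratedDeriv n g) := by
  induction n with
  | zero => simpa using hg
  | succ n ih =>
    rw [iteratedDeriv_succ]
    exact (contDiff_infty_iff_deriv.1 ih).2

theorem contDiff_prolong (s : ℝ) {g : ℝ → ℝ} (hg : ContDiff ℝ ∞ g) (m : ℕ) :
    ContDiff ℝ ∞ (prolong s g m) := by
  have h : ∀ n i, ContDiff ℝ ∞ (fun p : Base => iteratedDeriv n g (p i)) := fun n i =>
    (contDiff_iteratedDeriv hg n).comp (contDiff_pi.1 contDiff_id i)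
  exact contDiff_id.prodMk (contDiff_pi.2 fun α =>
    contDiff_const.mul (((h _ 0).mul (h _ 1)).mul (h _ 2)))

theorem fderiv_prolong (s : ℝ) {g : ℝ → ℝ} (hg : ContDiff ℝ ∞ g) (m : ℕ) (p : Base) (i : Fin 3) :
    fderiv ℝ (prolong s g m) p (Pi.single i 1) = shift i (prolong s g (m + 1) p) := by
  have h : ∀ n j, HasFDerivAt (fun p : Base => iteratedDeriv n g (p j))
      (iteratedDeriv (n + 1) g (p j) •
        ContinuousLinearMap.proj (R := ℝ) (φ := fun _ : Fin 3 => ℝ) j) p := by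
    intro n j
    have h1 : HasDerivAt (iteratedDeriv n g) (iteratedDeriv (n + 1) g (p j)) (p j) := by
      rw [iteratedDeriv_succ]
      exact ((contDiff_iteratedDeriv hg n).differentiable (by simp) _).hasDerivAt
    exact h1.comp_hasFDerivAt p
      (ContinuousLinearMap.proj (R := ℝ) (φ := fun _ : Fin 3 => ℝ) j).hasFDerivAt
  have hd : HasFDerivAt (prolong s g m) _ p :=
    (hasFDerivAt_id p).prodMk (hasFDerivAt_pi.2 fun α : MultiIndex m =>
      (((h (α.1 0) 0).mul (h (α.1 1) 1)).mul (h (α.1 2) 2)).const_mul s)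
  rw [hd.fderiv]
  refine Prod.ext rfl (funext fun α => ?_)
  fin_cases i <;> simp [shift, prolong, -mul_eq_mul_left_iff] <;> ring

/-- The chain rule along the jet of a function. It turns the Noether identity on jets into an
identity on the base, which can be integrated. -/
theorem totalDeriv_prolong (s : ℝ) {g : ℝ → ℝ} (hg : ContDiff ℝ ∞ g) {m : ℕ} {φ : Jet m → ℝ}
    (hφ : ContDiff ℝ ∞ φ) (p : Base) (i : Fin 3) :
    totalDeriv i φ (prolong s g (m + 1) p)
      = fderiv ℝ (fun p => φ (prolong s g m p)) p (Pi.single i 1) := by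
  have h1 := ((contDiff_prolong s hg m).differentiable (by simp) p).hasFDerivAt
  have h2 := (hφ.differentiable (by simp) (prolong s g m p)).hasFDerivAt
  have h3 : HasFDerivAt (fun p => φ (prolong s g m p)) _ p := h2.comp p h1
  rw [h3.fderiv, ContinuousLinearMap.comp_apply, fderiv_prolong s hg]
  rfl

theorem iteratedDeriv_eq_zero_of_notMem_tsupport {g : ℝ → ℝ} (n : ℕ) {x : ℝ}
    (hx : x ∉ tsupport g) : iteratedDeriv n g x = 0 := by
  rw [iteratedDeriv_eq_iteratedFDeriv]
  have : iteratedFDeriv ℝ n g x = 0 := by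
    by_contra h
    exact hx (support_iteratedFDeriv_subset n h)
  rw [this]
  rfl

theorem prolong_eq_of_notMem (s : ℝ) {g : ℝ → ℝ} (m : ℕ) {p : Base}
    (hp : p ∉ Set.univ.pi fun _ : Fin 3 => tsupport g) : prolong s g m p = prolong 0 g m p := by
  simp only [Set.mem_pi, Set.mem_univ, true_implies, not_forall] at hp
  obtain ⟨i, hi⟩ := hp
  refine Prod.ext rfl (funext fun α => ?_)
  have h : ∀ n, iteratedDeriv n g (p i) = 0 := fun n =>
    iteratedDeriv_eq_zero_of_notMem_tsupport n hi
  fin_cases i <;> simp at h <;> simp [prolong, h]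

/-- Integration by parts against the constant function 1. -/
theorem integral_fderiv_eq_zero {ψ : Base → ℝ} (hψ : ContDiff ℝ ∞ ψ) (hc : HasCompactSupport ψ)
    (v : Base) : ∫ p, fderiv ℝ ψ p v = 0 := by
  have hi : MeasureTheory.Integrable (fun p => fderiv ℝ ψ p v) :=
    ((hψ.continuous_fderiv (by simp)).clm_apply continuous_const).integrable_of_hasCompactSupport
      (hc.fderiv_apply ℝ v)
  have h := integral_mul_fderiv_eq_neg_fderiv_mul_of_integrable (f := fun _ : Base => (1 : ℝ))
    (g := ψ) (v := v) (μ := MeasureTheory.volume) (by simp) (by simpa using hi)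
    (by simpa using hψ.continuous.integrable_of_hasCompactSupport hc)
    (fun _ _ => differentiableAt_const _) (fun x _ => hψ.differentiable (by simp) x)
  simpa using h

/-! ### Exclusion of the dilation E. -/

theorem primitive_exp_sub {F : ℝ → ℝ} (hF : ∀ u, HasDerivAt F (Real.exp u) u) (u : ℝ) :
    F u - F 0 = Real.exp u - 1 := by
  have h : ∀ u, HasDerivAt (fun u => F u - Real.exp u) 0 u := fun u => by
    simpa using (hF u).fun_sub (Real.hasDerivAt_exp u)
  have := is_const_of_deriv_eq_zero (fun u => (h u).differentiableAt) (fun u => (h u).deriv) u 0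
  simp only [Real.exp_zero] at this
  linarith

theorem eq_zero_of_isNoetherSymmetry_combination {F : ℝ → ℝ}
    (hF : ∀ u, HasDerivAt F (Real.exp u) u) {a b c r κ : ℝ}
    (h : IsNoetherSymmetry (equation Real.exp) (lagrangian F) (combination a b c r κ)) :
    κ = 0 := by
  obtain ⟨-, -, m, φ, hφ, hid⟩ := h
  by_contra hκ
  let bump : ContDiffBump (0 : ℝ) := default
  obtain ⟨g, hg, hgc, hg0, hgpos⟩ : ∃ g : ℝ → ℝ, ContDiff ℝ ∞ g ∧ HasCompactSupport g ∧
      (∀ x, 0 ≤ g x) ∧ 0 < g 0 :=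
    ⟨bump, bump.contDiff, bump.hasCompactSupport, fun x => bump.nonneg,
      bump.pos_of_mem_ball (Metric.mem_ball_self bump.rOut_pos)⟩
  -- φ need not vanish on the jet of u = 0, so only this difference has compact support. The factor
  -- -1 makes u ≤ 0, which gives 1 - e^u ≥ 0.
  set ψ : Fin 3 → Base → ℝ := fun i p => φ i (prolong (-1) g m p) - φ i (prolong 0 g m p) with hψ
  have sφ : ∀ s i, ContDiff ℝ ∞ fun p => φ i (prolong s g m p) := fun s i =>
    (hφ i).comp (contDiff_prolong s hg m)
  have sψ : ∀ i, ContDiff ℝ ∞ (ψ i) := fun i => (sφ (-1) i).sub (sφ 0 i)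
  have cψ : ∀ i, HasCompactSupport (ψ i) := fun i =>
    HasCompactSupport.intro (isCompact_univ_pi fun _ : Fin 3 => hgc) fun p hp => by
      simp only [hψ, prolong_eq_of_notMem (-1) m hp, sub_self]
  set G : Base → ℝ := fun p => (2 * κ)⁻¹ * ∑ i, fderiv ℝ (ψ i) p (Pi.single i 1) with hG
  have cG : ∀ i : Fin 3, Continuous fun p => fderiv ℝ (ψ i) p (Pi.single i 1) := fun i =>
    ((sψ i).continuous_fderiv (by simp)).clm_apply continuous_const
  have G_cont : Continuous G := continuous_const.mul (continuous_finsetSum _ fun i _ => cG i)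
  have G_supp : HasCompactSupport G := by
    have h3 := (((cψ 0).fderiv_apply ℝ (Pi.single 0 1)).add
      ((cψ 1).fderiv_apply ℝ (Pi.single 1 1))).add ((cψ 2).fderiv_apply ℝ (Pi.single 2 1))
    have h4 : HasCompactSupport fun p => ∑ i, fderiv ℝ (ψ i) p (Pi.single i 1) := by
      simp only [Fin.sum_univ_three]
      exact h3
    exact h4.mul_left
  have G_int : ∫ p, G p = 0 := by
    rw [hG, MeasureTheory.integral_const_mul, MeasureTheory.integral_finsetSum]
    · simp [integral_fderiv_eq_zero (sψ _) (cψ _)]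
    · exact fun i _ => (cG i).integrable_of_hasCompactSupport ((cψ i).fderiv_apply ℝ _)
  have key : ∀ p, ∃ e : ℝ, 0 ≤ e ∧ G p = e + (1 - Real.exp (-(g (p 0) * g (p 1) * g (p 2)))) := by
    intro p
    have hs : ∀ s, 2 * κ * (lagrangian F (prolong s g 1 p)
        + Real.exp (s * (g (p 0) * g (p 1) * g (p 2)))
        - F (s * (g (p 0) * g (p 1) * g (p 2))))
        = ∑ i, fderiv ℝ (fun p => φ i (prolong s g m p)) p (Pi.single i 1) := by
      intro s
      have := hid (prolong s g (m + 1) p)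
      simp only [noether_combination hF, totalDeriv_prolong s hg (hφ _)] at this
      rw [← this]
      simp [coord, idx, trunc, prolong, ofList]
    have hd : ∑ i, fderiv ℝ (ψ i) p (Pi.single i 1)
        = ∑ i, fderiv ℝ (fun p => φ i (prolong (-1) g m p)) p (Pi.single i 1)
          - ∑ i, fderiv ℝ (fun p => φ i (prolong 0 g m p)) p (Pi.single i 1) := by
      rw [← Finset.sum_sub_distrib]
      refine Finset.sum_congr rfl fun i _ => ?_
      rw [hψ, fderiv_fun_sub ((sφ (-1) i).differentiable (by simp) p)
        ((sφ 0 i).differentiable (by simp) p)]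
      rfl
    set w := -(g (p 0) * g (p 1) * g (p 2)) with hw
    have hF' := primitive_exp_sub hF w
    set z := prolong (-1) g 1 p with hz
    -- The quadratic part of the Lagrangian as ½(Xu)² + ½(Yu)². The remainder e^u - 1 - 2(F(u) -
    -- F(0)) equals 1 - e^u.
    refine ⟨1 / 2 * (coord z [0] (le_refl 1) + 2 * p 1 * coord z [2] (le_refl 1)) ^ 2
      + 1 / 2 * (coord z [1] (le_refl 1) - 2 * p 0 * coord z [2] (le_refl 1)) ^ 2,
      by positivity, ?_⟩
    have c0 : ∀ l h, coord (prolong 0 g 1 p) l h = 0 := fun l h => by simp [coord, prolong]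
    have cz : coord z [] (Nat.zero_le 1) = w := by
      simp [coord, idx, hz, prolong, ofList, hw]
    have b0 : z.1 = p := rfl
    simp only [hG, hd, ← hs]
    rw [zero_mul, neg_one_mul, ← hw]
    rw [← hz]
    simp only [lagrangian, c0, cz, b0, Real.exp_zero]
    field_simp
    linear_combination (-4) * hF'
  have G_nonneg : 0 ≤ G := fun p => by
    obtain ⟨e, he, hp⟩ := key p
    have h1 : Real.exp (-(g (p 0) * g (p 1) * g (p 2))) ≤ 1 :=
      Real.exp_le_one_iff.2 (neg_nonpos.2 (mul_nonneg (mul_nonneg (hg0 _) (hg0 _)) (hg0 _)))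
    rw [hp, Pi.zero_apply]
    linarith
  have G_ne : G 0 ≠ 0 := by
    obtain ⟨e, he, hp⟩ := key 0
    have h1 : Real.exp (-(g 0 * g 0 * g 0)) < 1 :=
      Real.exp_lt_one_iff.2 (neg_lt_zero.2 (mul_pos (mul_pos hgpos hgpos) hgpos))
    rw [hp]
    simp only [Pi.zero_apply]
    linarith
  exact (G_cont.integral_pos_of_hasCompactSupport_nonneg_nonzero
    (μ := MeasureTheory.volume) G_supp G_nonneg G_ne).ne' G_int

end KohnLaplace

end

/-- For `f(u) = eᵘ` and any primitive `F` of `f`, the Noether symmetries of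
`Δ_{H¹} u + f(u) = 0` are exactly the elements of `G_f`; the additional Lie point symmetry `E` is
not a Noether symmetry. -/
theorem theorem2 (F : ℝ → ℝ) (hF : ∀ u, HasDerivAt F (Real.exp u) u) :
    (∀ S : KohnLaplace.PointField,
      KohnLaplace.IsNoetherSymmetry (KohnLaplace.equation Real.exp) (KohnLaplace.lagrangian F) S
        ↔ S ∈ KohnLaplace.generatorsG) ∧
    KohnLaplace.IsLiePointSymmetry (KohnLaplace.equation Real.exp) KohnLaplace.fieldE ∧
    ¬ KohnLaplace.IsNoetherSymmetry (KohnLaplace.equation Real.exp) (KohnLaplace.lagrangian F)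
        KohnLaplace.fieldE := by
  have hE : KohnLaplace.fieldE = KohnLaplace.combination 0 0 0 0 1 := by
    simp [KohnLaplace.combination_eq]
  refine ⟨fun S => ⟨fun h => ?_, fun h => ?_⟩, ?_, fun h => ?_⟩
  · obtain ⟨a, b, c, r, κ, rfl⟩ := KohnLaplace.eq_combination_of_isLiePointSymmetry h.2.1
    obtain rfl := KohnLaplace.eq_zero_of_isNoetherSymmetry_combination hF h
    exact KohnLaplace.mem_generatorsG_iff.2 ⟨a, b, c, r, rfl⟩
  · obtain ⟨a, b, c, r, rfl⟩ := KohnLaplace.mem_generatorsG_iff.1 h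
    exact KohnLaplace.combination_isNoetherSymmetry hF a b c r
  · rw [hE]
    exact KohnLaplace.combination_isLiePointSymmetry 0 0 0 0 1
  · rw [hE] at h
    exact one_ne_zero (KohnLaplace.eq_zero_of_isNoetherSymmetry_combination hF h)
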